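/- Let $n\ge 1$, $0<s<1<p<\infty$, and let $W^{s,p}(\mathbb{R}^n)$ be the space of $u\in L^p(\mathbb{R}^n)$ with $$[u]_{s,p}^p=\iint_{\mathbb{R}^n\times\mathbb{R}^n}\frac{|u(x)-u(y)|^p}{|x-y|^{n+sp}}\,dx\,dy<\infty,\qquad \|u\|_{s,p}=\big(\|u\|_{L^p}^p+[u]_{s,p}^p\big)^{1/p}.$$ Let $D\subset\mathbb{R}^n$ be bounded and open, and let $\Omega\subset D$ and $\Omega_k\subset D$ ($k\in\mathbb{N}$) be open. For open $O\subset\mathbb{R}^n$ let $W_0^{s,p}(O)$ denote one of the following spaces, the same choice being made for all sets $O$: (a) the closure of $C_c^\infty(O)$ in $W^{s,p}(\mathbb{R}^n)$; or (b) $\{u\in W^{s,p}(\mathbb{R}^n): u=0 \text{ a.e. in } \mathbb{R}^n\setminus O\}$, in which case it is assumed in addition that for the set $O=\Omega$ the spaces in (a) and (b) coincide (for instance, $\Omega$ is Lipschitz). Let $f\in W^{-s,p'}(D):=[W_0^{s,p}(D)]'$. For every open $O\subset D$ there is a unique $u_O^f\in W_0^{s,p}(O)$ such that $$\iint_{\mathbb{R}^n\times\mathbb{R}^n}\frac{|u_O^f(x)-u_O^f(y)|^{p-2}(u_O^f(x)-u_O^f(y))(v(x)-v(y))}{|x-y|^{n+sp}}\,dx\,dy=\langle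 f,v\rangle\quad\text{for all } v\in W_0^{s,p}(O).$$ For $E\subset D$ put $$\operatorname{cap}_{s,p}(E,D)=\inf\{[u]_{s,p}^p: u\in W_0^{s,p}(D),\ u\ge 1 \text{ a.e. in an open neighborhood of } E\}$$ (with $\inf\emptyset=\infty$). Assume that $\Omega_k\to\Omega$ in the Hausdorff complementary topology, that is, the Hausdorff distance between $\overline D\setminus\Omega_k$ and $\overline D\setminus\Omega$ tends to $0$, and that $$\operatorname{cap}_{s,p}(\Omega_k\setminus\Omega,D)\to 0 .$$ Then $u_{\Omega_k}^f\to u_\Omega^f$ strongly in $W_0^{s,p}(D)$, that is, $\|u_{\Omega_k}^f-u_\Omega^f\|_{s,p}\to 0$. -/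

import Mathlib

open MeasureTheory Filter Topology
open scoped ENNReal NNReal ContDiff

namespace FracDirichlet

/-- Euclidean space `ℝⁿ`. -/
abbrev E (n : ℕ) : Type := EuclideanSpace ℝ (Fin n)

variable {n : ℕ}

/-- The difference quotient `(u x - u y) / |x - y| ^ (n / p + s)` on `ℝⁿ × ℝⁿ`. -/
noncomputable def quot (s p : ℝ) (u : E n → ℝ) (z : E n × E n) : ℝ :=
  (u z.1 - u z.2) / ‖z.1 - z.2‖ ^ ((n : ℝ) / p + s)

/-- The `p`-th power `[u]_{s,p}^p` of the Gagliardo seminorm on `ℝⁿ`. -/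
noncomputable def gagliardo (s p : ℝ) (u : E n → ℝ) : ℝ≥0∞ :=
  ∫⁻ z : E n × E n, ENNReal.ofReal (|u z.1 - u z.2| ^ p / ‖z.1 - z.2‖ ^ ((n : ℝ) + s * p))

/-- The norm `‖u‖_{s,p} = (∫ |u|^p + [u]_{s,p}^p)^{1/p}` (possibly infinite). -/
noncomputable def sobolevNorm (s p : ℝ) (u : E n → ℝ) : ℝ≥0∞ :=
  ((∫⁻ x, ENNReal.ofReal (|u x| ^ p)) + gagliardo s p u) ^ (1 / p)

/-- The space `W^{s,p}(ℝⁿ)`, given by the functions representing its elements: `u` and its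
difference quotient are `p`-integrable. -/
noncomputable def W (n : ℕ) (s p : ℝ) : Submodule ℝ (E n → ℝ) where
  carrier := {u | MemLp u (ENNReal.ofReal p) volume ∧
    MemLp (quot s p u) (ENNReal.ofReal p) (volume : Measure (E n × E n))}
  zero_mem' := by
    refine ⟨MemLp.zero, ?_⟩
    have : quot s p (0 : E n → ℝ) = 0 := by funext z; simp [quot]
    rw [this]; exact MemLp.zero
  add_mem' := by
    rintro u v ⟨hu, hu'⟩ ⟨hv, hv'⟩
    refine ⟨hu.add hv, ?_⟩
    have : quot s p (u + v) = quot s p u + quot s p v := by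
      funext z; simp only [quot, Pi.add_apply]; ring
    rw [this]; exact hu'.add hv'
  smul_mem' := by
    rintro c u ⟨hu, hu'⟩
    refine ⟨hu.const_smul c, ?_⟩
    have : quot s p (c • u) = c • quot s p u := by
      funext z; simp only [quot, Pi.smul_apply, smul_eq_mul]; ring
    rw [this]; exact hu'.const_smul c

theorem mem_W {s p : ℝ} {u : E n → ℝ} : u ∈ W n s p ↔
    MemLp u (ENNReal.ofReal p) volume ∧
      MemLp (quot s p u) (ENNReal.ofReal p) (volume : Measure (E n × E n)) := Iff.rfl

theorem sobolevNorm_eq {s p : ℝ} (hp : 1 < p) (u : E n → ℝ) :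
    sobolevNorm s p u = (eLpNorm u (ENNReal.ofReal p) volume ^ p +
      eLpNorm (quot s p u) (ENNReal.ofReal p) (volume : Measure (E n × E n)) ^ p) ^ (1 / p) := by
  have hp0 : 0 < p := by linarith
  have h0 : ENNReal.ofReal p ≠ 0 := by simpa using hp0
  have key : ∀ a : ℝ≥0∞, (a ^ (1 / p)) ^ p = a := by
    intro a
    rw [← ENNReal.rpow_mul, one_div, inv_mul_cancel₀ hp0.ne', ENNReal.rpow_one]
  rw [eLpNorm_eq_lintegral_rpow_enorm_toReal h0 ENNReal.ofReal_ne_top,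
    eLpNorm_eq_lintegral_rpow_enorm_toReal h0 ENNReal.ofReal_ne_top,
    ENNReal.toReal_ofReal hp0.le, key, key, sobolevNorm, gagliardo]
  congr 2
  · refine lintegral_congr fun x => ?_
    rw [← ofReal_norm, ENNReal.ofReal_rpow_of_nonneg (norm_nonneg _) hp0.le,
      Real.norm_eq_abs]
  · refine lintegral_congr fun z => ?_
    rw [← ofReal_norm, ENNReal.ofReal_rpow_of_nonneg (norm_nonneg _) hp0.le,
      Real.norm_eq_abs, quot, abs_div, abs_of_nonneg (Real.rpow_nonneg (norm_nonneg _) _),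
      Real.div_rpow (abs_nonneg _) (Real.rpow_nonneg (norm_nonneg _) _),
      ← Real.rpow_mul (norm_nonneg _)]
    congr 3
    field_simp

theorem sobolevNorm_zero {s p : ℝ} (hp : 1 < p) : sobolevNorm s p (0 : E n → ℝ) = 0 := by
  have hp0 : 0 < p := by linarith
  have : quot s p (0 : E n → ℝ) = 0 := by funext z; simp [quot]
  rw [sobolevNorm_eq hp, this]
  simp [hp0]

theorem sobolevNorm_add_le {s p : ℝ} (hp : 1 < p) {u v : E n → ℝ}
    (hu : u ∈ W n s p) (hv : v ∈ W n s p) :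
    sobolevNorm s p (u + v) ≤ sobolevNorm s p u + sobolevNorm s p v := by
  have hp0 : 0 < p := by linarith
  have h1 : 1 ≤ ENNReal.ofReal p := by simpa using hp.le
  have hq : quot s p (u + v) = quot s p u + quot s p v := by
    funext z; simp only [quot, Pi.add_apply]; ring
  have a1 := eLpNorm_add_le hu.1.1 hv.1.1 h1
  have a2 := eLpNorm_add_le hu.2.1 hv.2.1 h1
  rw [sobolevNorm_eq hp, sobolevNorm_eq hp, sobolevNorm_eq hp, hq]
  refine le_trans ?_ (by
    simpa [Fin.sum_univ_two] using ENNReal.Lp_add_le (Finset.univ : Finset (Fin 2))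
      ![eLpNorm u (ENNReal.ofReal p) volume,
        eLpNorm (quot s p u) (ENNReal.ofReal p) (volume : Measure (E n × E n))]
      ![eLpNorm v (ENNReal.ofReal p) volume,
        eLpNorm (quot s p v) (ENNReal.ofReal p) (volume : Measure (E n × E n))] hp.le)
  rw [one_div]
  gcongr

theorem sobolevNorm_smul {s p : ℝ} (hp : 1 < p) (c : ℝ) (u : E n → ℝ) :
    sobolevNorm s p (c • u) = ‖c‖ₑ * sobolevNorm s p u := by
  have hp0 : 0 < p := by linarith
  have hq : quot s p (c • u) = c • quot s p u := by
    funext z; simp only [quot, Pi.smul_apply, smul_eq_mul]; ring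
  rw [sobolevNorm_eq hp, sobolevNorm_eq hp, hq, eLpNorm_const_smul, eLpNorm_const_smul,
    ENNReal.mul_rpow_of_nonneg _ _ hp0.le, ENNReal.mul_rpow_of_nonneg _ _ hp0.le, ← mul_add,
    ENNReal.mul_rpow_of_nonneg _ _ (by positivity), ← ENNReal.rpow_mul, one_div,
    mul_inv_cancel₀ hp0.ne', ENNReal.rpow_one]

/-- `C_c^∞(Ω)`, extended by zero to `ℝⁿ`. -/
def IsTest (Ω : Set (E n)) (φ : E n → ℝ) : Prop :=
  ContDiff ℝ ∞ φ ∧ HasCompactSupport φ ∧ tsupport φ ⊆ Ω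

/-- The closure of `W^{s,p}(ℝⁿ) ∩ C_c^∞(Ω)` in `W^{s,p}(ℝⁿ)` for the norm `‖·‖_{s,p}`; test functions
always belong to `W^{s,p}(ℝⁿ)` when `0 < s < 1 < p`. -/
noncomputable def W₀ (s : ℝ) {p : ℝ} (hp : 1 < p) (Ω : Set (E n)) : Submodule ℝ (E n → ℝ) where
  carrier := {u | u ∈ W n s p ∧ ∀ ε : ℝ≥0∞, 0 < ε →
    ∃ φ, φ ∈ W n s p ∧ IsTest Ω φ ∧ sobolevNorm s p (u - φ) < ε}
  zero_mem' := by
    refine ⟨zero_mem _, fun ε hε => ⟨0, zero_mem _, ⟨contDiff_const, .zero, ?_⟩, ?_⟩⟩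
    · simp
    · rw [sub_zero, sobolevNorm_zero hp]; exact hε
  add_mem' := by
    rintro u v ⟨hu, hu'⟩ ⟨hv, hv'⟩
    refine ⟨add_mem hu hv, fun ε hε => ?_⟩
    obtain ⟨φ, hφ, ⟨a1, a2, a3⟩, h1⟩ := hu' (ε / 2) (ENNReal.half_pos hε.ne')
    obtain ⟨ψ, hψ, ⟨b1, b2, b3⟩, h2⟩ := hv' (ε / 2) (ENNReal.half_pos hε.ne')
    refine ⟨φ + ψ, add_mem hφ hψ, ⟨a1.add b1, a2.add b2, ?_⟩, ?_⟩
    · exact (tsupport_add φ ψ).trans (Set.union_subset a3 b3)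
    · rw [add_sub_add_comm]
      refine (sobolevNorm_add_le hp (sub_mem hu hφ) (sub_mem hv hψ)).trans_lt ?_
      calc _ < ε / 2 + ε / 2 := ENNReal.add_lt_add h1 h2
        _ = ε := ENNReal.add_halves ε
  smul_mem' := by
    rintro c u ⟨hu, hu'⟩
    refine ⟨(W n s p).smul_mem c hu, fun ε hε => ?_⟩
    have hd : ‖c‖ₑ + 1 ≠ ⊤ := by simp
    obtain ⟨φ, hφ, ⟨a1, a2, a3⟩, h1⟩ := hu' (ε / (‖c‖ₑ + 1)) (ENNReal.div_pos hε.ne' hd)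
    refine ⟨c • φ, (W n s p).smul_mem c hφ, ⟨contDiff_const.smul a1, ?_, ?_⟩, ?_⟩
    · exact a2.smul_left (f := fun _ => c)
    · exact (tsupport_smul_subset_right (fun _ => c) φ).trans a3
    · rw [← smul_sub, sobolevNorm_smul hp]
      refine lt_of_le_of_lt (mul_le_mul_left (le_add_of_nonneg_right zero_le_one) _) ?_
      rw [mul_comm]
      exact (ENNReal.lt_div_iff_mul_lt (Or.inl (by simp)) (Or.inl hd)).1 h1

/-- The space `{u ∈ W^{s,p}(ℝⁿ) : u = 0 a.e. in ℝⁿ \ Ω}`. -/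
noncomputable def W₀ae (s p : ℝ) (Ω : Set (E n)) : Submodule ℝ (E n → ℝ) where
  carrier := {u | u ∈ W n s p ∧ ∀ᵐ x, x ∉ Ω → u x = 0}
  zero_mem' := ⟨zero_mem _, .of_forall fun _ _ => rfl⟩
  add_mem' := by
    rintro u v ⟨hu, hu'⟩ ⟨hv, hv'⟩
    refine ⟨add_mem hu hv, ?_⟩
    filter_upwards [hu', hv'] with x h1 h2 hx
    simp [h1 hx, h2 hx]
  smul_mem' := by
    rintro c u ⟨hu, hu'⟩
    refine ⟨(W n s p).smul_mem c hu, ?_⟩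
    filter_upwards [hu'] with x h1 hx
    simp [h1 hx]

/-- The pairing `⟨(-Δ_p)^s u, v⟩`. -/
noncomputable def fracPLap (s p : ℝ) (u v : E n → ℝ) : ℝ :=
  ∫ z : E n × E n, |u z.1 - u z.2| ^ (p - 2) * (u z.1 - u z.2) * (v z.1 - v z.2) /
    ‖z.1 - z.2‖ ^ ((n : ℝ) + s * p)

/-- A linear functional on a space `X` of functions is bounded for the norm `‖·‖_{s,p}`. -/
def IsBoundedFunctional (s p : ℝ) {X : Submodule ℝ (E n → ℝ)} (f : X →ₗ[ℝ] ℝ) : Prop :=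
  ∃ C : ℝ≥0, ∀ v : X, ‖f v‖ₑ ≤ C * sobolevNorm s p (v : E n → ℝ)

/-- `u ∈ Y` solves `⟨(-Δ_p)^s u, v⟩ = ⟨f, v⟩` for all `v ∈ Y`; here `Y` stands for the space
attached to `Ω`, contained in the space `X` attached to `D`, and `f` is a functional on `X`. -/
def IsWeakSolution (s p : ℝ) {X : Submodule ℝ (E n → ℝ)} (f : X →ₗ[ℝ] ℝ)
    (Y : Submodule ℝ (E n → ℝ)) (u : E n → ℝ) : Prop :=
  u ∈ Y ∧ ∀ v : X, (v : E n → ℝ) ∈ Y → fracPLap s p u v = f v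

/-- Relative capacity of `A`: infimum of `[u]_{s,p}^p` over `u` in `X` (the space attached to `D`)
with `u ≥ 1` a.e. in an open neighbourhood of `A`; it is `∞` if there is no such `u`. -/
noncomputable def relCap (s p : ℝ) (X : Submodule ℝ (E n → ℝ)) (A : Set (E n)) : ℝ≥0∞ :=
  ⨅ u ∈ {u : E n → ℝ | u ∈ X ∧ ∃ U, IsOpen U ∧ A ⊆ U ∧ ∀ᵐ x, x ∈ U → 1 ≤ u x},
    gagliardo s p u

/-- Convergence in the Hausdorff complementary topology of open subsets of `D`: the
complements in the compact set `closure D` converge for the Hausdorff distance. -/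
def HausdorffComplTendsto (D : Set (E n)) (Ωk : ℕ → Set (E n)) (Ω : Set (E n)) : Prop :=
  Tendsto (fun k => Metric.hausdorffEDist (closure D \ Ωk k) (closure D \ Ω)) atTop (𝓝 0)

end FracDirichlet

/-! The map sending `u` to its difference quotient takes values in L^p(ℝⁿ × ℝⁿ) and turns the
Gagliardo seminorm into the L^p norm. Since D is bounded, a fractional Poincaré inequality makes
this seminorm equivalent to the full norm on functions vanishing off D, so the spaces attached to
open O ⊆ D become closed subspaces of L^p (`isClosed_quotImage`). By Hahn–Banach, f extends to a
continuous functional F on L^p, and the weak solutions are exactly the minimizers of J(g) = ‖g‖^p/p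
− F(g) on these subspaces (`isWeakSolution_iff`). J is uniformly convex on bounded sets, which gives
existence and uniqueness.

For convergence, write u_k and u for the solutions on Ω_k and Ω. Two facts are needed. Upper bound:
u is a limit of test functions on Ω, whose compact supports lie in Ω_k for large k by Hausdorff
convergence, so limsup J(u_k) ≤ J(u) (`eventually_energy_le`). Weak closeness to the limit space:
take w_k with w_k ≥ 1 near Ω_k \ Ω and small seminorm, truncate (an approximation of) u_k at a
height M_k → ∞ and multiply by 1 − w_k clamped to [0, 1]. The result lies in the space of Ω, stays
bounded if M_k grows slowly, and is close to u_k in L¹ on sets of finite measure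
(`IsZeroTraceFamily.exists_approx_seq`).

The conclusion is abstract (`tendsto_of_asymptotically_mem`). If u_k stayed away from u along a
subsequence, uniform convexity would push the energy of (u_k + u)/2 below J(u) by a fixed amount.
Passing to a generalized weak limit z, which lies in the space of Ω, would give (z + u)/2 an energy
below the minimum. Weak limits are replaced by common points of the closed convex hulls of the
tails, which exist by uniform convexity (`nonempty_iInter`). -/

namespace FracDirichlet

/-! ### Uniformly convex functionals: minimizers and a substitute for weak compactness. -/

/-- Continuous, convex, coercive functionals, bounded below and uniformly convex on bounded sets. -/
structure IsUnifConvexFunctional {X : Type*} [NormedAddCommGroup X] [NormedSpace ℝ X]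
    (J : X → ℝ) : Prop where
  continuous : Continuous J
  convexOn : ConvexOn ℝ Set.univ J
  gap : ∀ R ε : ℝ, 0 < ε → ∃ δ > 0, ∀ x y : X, ‖x‖ ≤ R → ‖y‖ ≤ R → ε ≤ ‖x - y‖ →
    J ((1 / 2 : ℝ) • (x + y)) + δ ≤ (J x + J y) / 2
  coercive : ∀ c : ℝ, ∃ R : ℝ, ∀ x, J x ≤ c → ‖x‖ ≤ R
  bddBelow : ∃ b : ℝ, ∀ x, b ≤ J x

namespace IsUnifConvexFunctional

variable {X : Type*} [NormedAddCommGroup X] [NormedSpace ℝ X] {J : X → ℝ}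

theorem midpoint_le (hJ : IsUnifConvexFunctional J) (x y : X) :
    J ((1 / 2 : ℝ) • (x + y)) ≤ (J x + J y) / 2 := by
  have h : (0 : ℝ) ≤ 1 / 2 := by norm_num
  have := hJ.convexOn.2 (Set.mem_univ x) (Set.mem_univ y) h h (by norm_num)
  rw [smul_add]
  simp only [smul_eq_mul] at this
  linarith

theorem mem_midpoint {C : Set X} (hC : Convex ℝ C) {x y : X} (hx : x ∈ C) (hy : y ∈ C) :
    (1 / 2 : ℝ) • (x + y) ∈ C := by
  rw [smul_add]
  exact hC hx hy (by norm_num) (by norm_num) (by norm_num)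

/-- A decreasing sequence of closed convex sets which all meet a fixed sublevel set of `J` has
a common point. -/
theorem nonempty_iInter [CompleteSpace X] (hJ : IsUnifConvexFunctional J) {C : ℕ → Set X}
    (hanti : Antitone C) (hcl : ∀ k, IsClosed (C k)) (hcv : ∀ k, Convex ℝ (C k)) {c : ℝ}
    (hc : ∀ k, ∃ x ∈ C k, J x ≤ c) : (⋂ k, C k).Nonempty := by
  obtain ⟨b, hb⟩ := hJ.bddBelow
  have hne : ∀ k, (J '' C k).Nonempty := fun k => by
    obtain ⟨x, hx, -⟩ := hc k
    exact ⟨_, x, hx, rfl⟩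
  have hbd : ∀ k, BddBelow (J '' C k) := fun k => ⟨b, by rintro _ ⟨x, -, rfl⟩; exact hb x⟩
  set m : ℕ → ℝ := fun k => sInf (J '' C k) with hm
  have hmono : Monotone m := fun i j hij =>
    csInf_le_csInf (hbd i) (hne j) (Set.image_mono (hanti hij))
  have hmc : ∀ k, m k ≤ c := fun k => by
    obtain ⟨x, hx, hxc⟩ := hc k
    exact (csInf_le (hbd k) ⟨x, hx, rfl⟩).trans hxc
  have hbdd : BddAbove (Set.range m) := ⟨c, by rintro _ ⟨k, rfl⟩; exact hmc k⟩
  have hlim : Tendsto m atTop (𝓝 (⨆ k, m k)) := tendsto_atTop_ciSup hmono hbdd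
  set M := ⨆ k, m k with hM
  have hmM : ∀ k, m k ≤ M := fun k => le_ciSup hbdd k
  have hex : ∀ k : ℕ, ∃ x ∈ C k, J x < M + 1 / ((k : ℝ) + 1) := fun k => by
    have hlt : sInf (J '' C k) < M + 1 / ((k : ℝ) + 1) :=
      (hmM k).trans_lt (lt_add_of_pos_right _ (by positivity))
    obtain ⟨_, ⟨x, hx, rfl⟩, h⟩ := exists_lt_of_csInf_lt (hne k) hlt
    exact ⟨x, hx, h⟩
  choose x hxC hxJ using hex
  obtain ⟨R, hR⟩ := hJ.coercive (M + 1)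
  have hxR : ∀ k, ‖x k‖ ≤ R := fun k => hR _ <| (hxJ k).le.trans <| by
    gcongr
    rw [div_le_one (by positivity)]
    linarith [(Nat.cast_nonneg k : (0 : ℝ) ≤ k)]
  have hcau : CauchySeq x := by
    refine Metric.cauchySeq_iff'.2 fun ε hε => ?_
    obtain ⟨δ, hδ, hgap⟩ := hJ.gap R ε hε
    have h1 : ∀ᶠ k in atTop, M - δ / 2 < m k := hlim.eventually_const_lt (by linarith)
    have h2 : ∀ᶠ k : ℕ in atTop, 1 / ((k : ℝ) + 1) < δ / 2 :=
      tendsto_one_div_add_atTop_nhds_zero_nat.eventually_lt_const (by linarith)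
    obtain ⟨N, hN1, hN2⟩ := (h1.and h2).exists
    refine ⟨N, fun k hk => ?_⟩
    by_contra! hcon
    rw [dist_eq_norm] at hcon
    have h3 := hgap _ _ (hxR k) (hxR N) hcon
    -- Both points lie in `C N`, hence so does their midpoint. The gap would give it an energy below
    -- M + δ/2 − δ, which is less than `m N`.
    have h4 : m N ≤ J ((1 / 2 : ℝ) • (x k + x N)) :=
      csInf_le (hbd N) ⟨_, mem_midpoint (hcv N) (hanti hk (hxC k)) (hxC N), rfl⟩
    have h5 : 1 / ((k : ℝ) + 1) ≤ 1 / ((N : ℝ) + 1) := by gcongr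
    linarith [hxJ k, hxJ N]
  obtain ⟨z, hz⟩ := cauchySeq_tendsto_of_complete hcau
  refine ⟨z, Set.mem_iInter.2 fun k => (hcl k).mem_of_tendsto hz ?_⟩
  filter_upwards [eventually_ge_atTop k] with j hj using hanti hj (hxC j)

/-- The parts of `C` where `J` is at most its infimum plus 1/(k+1) are closed, convex, nested and
nonempty; a common point is a minimizer. -/
theorem exists_isMinOn [CompleteSpace X] (hJ : IsUnifConvexFunctional J) {C : Set X}
    (hcl : IsClosed C) (hcv : Convex ℝ C) (hne : C.Nonempty) : ∃ z ∈ C, ∀ x ∈ C, J z ≤ J x := by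
  obtain ⟨b, hb⟩ := hJ.bddBelow
  have hbd : BddBelow (J '' C) := ⟨b, by rintro _ ⟨x, -, rfl⟩; exact hb x⟩
  have hsub : ∀ r : ℝ, Convex ℝ {x | J x ≤ r} := fun r => by
    simpa using hJ.convexOn.convex_le r
  have := hJ.nonempty_iInter (C := fun k : ℕ => C ∩ {x | J x ≤ sInf (J '' C) + 1 / ((k : ℝ) + 1)})
    (fun i j hij x hx => ⟨hx.1, le_trans (b := sInf (J '' C) + 1 / ((j : ℝ) + 1)) hx.2
      (by gcongr)⟩)
    (fun k => hcl.inter (isClosed_le hJ.continuous continuous_const))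
    (fun k => hcv.inter (hsub _)) (c := sInf (J '' C) + 1) (fun k => by
      obtain ⟨_, ⟨x, hx, rfl⟩, h⟩ := exists_lt_of_csInf_lt (hne.image J)
        (lt_add_of_pos_right (sInf (J '' C)) (show 0 < 1 / ((k : ℝ) + 1) by positivity))
      refine ⟨x, ⟨hx, h.le⟩, h.le.trans ?_⟩
      gcongr
      rw [div_le_one (by positivity)]
      linarith [(Nat.cast_nonneg k : (0 : ℝ) ≤ k)])
  obtain ⟨z, hz⟩ := this
  rw [Set.mem_iInter] at hz
  refine ⟨z, (hz 0).1, fun x hx => ?_⟩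
  have h1 : J z ≤ sInf (J '' C) := by
    refine le_of_forall_pos_lt_add fun ε hε => ?_
    obtain ⟨k, hk⟩ := exists_nat_one_div_lt hε
    exact lt_of_le_of_lt (hz k).2 (by linarith)
  exact h1.trans (csInf_le hbd ⟨x, hx, rfl⟩)

theorem eq_of_isMinOn (hJ : IsUnifConvexFunctional J) {C : Set X} (hcv : Convex ℝ C) {x y : X}
    (hx : x ∈ C) (hy : y ∈ C) (hx' : ∀ z ∈ C, J x ≤ J z) (hy' : ∀ z ∈ C, J y ≤ J z) : x = y := by
  by_contra hne
  obtain ⟨δ, hδ, h⟩ := hJ.gap (max ‖x‖ ‖y‖) ‖x - y‖ (norm_pos_iff.2 (sub_ne_zero.2 hne))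
  have h1 := h x y (le_max_left _ _) (le_max_right _ _) le_rfl
  have h2 := hx' _ (mem_midpoint hcv hx hy)
  have h3 := hy' _ (mem_midpoint hcv hx hy)
  linarith

/-- Allows two sequences to be followed by the same convex combinations, so that linear relations
between them survive in the limit. In the sup norm, points at distance ε differ by ε in one
coordinate; midpoint convexity handles the other. -/
theorem prod (hJ : IsUnifConvexFunctional J) :
    IsUnifConvexFunctional (fun z : X × X => J z.1 + J z.2) where
  continuous := (hJ.continuous.comp continuous_fst).add (hJ.continuous.comp continuous_snd)
  convexOn := by
    refine ⟨convex_univ, fun x _ y _ a b ha hb hab => ?_⟩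
    have h1 := hJ.convexOn.2 (Set.mem_univ x.1) (Set.mem_univ y.1) ha hb hab
    have h2 := hJ.convexOn.2 (Set.mem_univ x.2) (Set.mem_univ y.2) ha hb hab
    simp only [smul_eq_mul, Prod.fst_add, Prod.snd_add, Prod.smul_fst, Prod.smul_snd] at *
    linarith
  gap := by
    intro R ε hε
    obtain ⟨δ, hδ, h⟩ := hJ.gap R ε hε
    refine ⟨δ, hδ, fun x y hx hy hxy => ?_⟩
    rw [Prod.norm_def, sup_le_iff] at hx hy
    rw [Prod.norm_def, le_sup_iff] at hxy
    have m1 := hJ.midpoint_le x.1 y.1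
    have m2 := hJ.midpoint_le x.2 y.2
    simp only [Prod.fst_add, Prod.snd_add, Prod.smul_fst, Prod.smul_snd]
    rcases hxy with hxy | hxy
    · linarith [h _ _ hx.1 hy.1 hxy]
    · linarith [h _ _ hx.2 hy.2 hxy]
  coercive := by
    intro c
    obtain ⟨b, hb⟩ := hJ.bddBelow
    obtain ⟨R, hR⟩ := hJ.coercive (c - b)
    refine ⟨R, fun x hx => sup_le (hR _ ?_) (hR _ ?_)⟩
    · linarith [hb x.2]
    · linarith [hb x.1]
  bddBelow := by
    obtain ⟨b, hb⟩ := hJ.bddBelow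
    exact ⟨b + b, fun x => add_le_add (hb _) (hb _)⟩

/-- Strong convergence of almost minimizers `x k` to the minimizer `u` of `J` on the closed
subspace `S`, if the `x k` are asymptotically, in a weak sense, in `S`. -/
theorem tendsto_of_asymptotically_mem [CompleteSpace X] (hJ : IsUnifConvexFunctional J)
    {S T : Submodule ℝ X} (hScl : IsClosed (S : Set X)) (hTcl : IsClosed (T : Set X)) (hST : S ≤ T)
    {u : X} (huS : u ∈ S) (hu : ∀ z ∈ S, J u ≤ J z) {x g : ℕ → X} (hxT : ∀ k, x k ∈ T)
    (hx : ∀ c, J u < c → ∀ᶠ k in atTop, J (x k) ≤ c) (hgS : ∀ k, g k ∈ S)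
    {c₀ : ℝ} (hg : ∀ k, J (g k) ≤ c₀) {ι : Type*} (ℓ : ι → X →L[ℝ] ℝ)
    (hℓ : ∀ i, Tendsto (fun k => ℓ i (x k - g k)) atTop (𝓝 0))
    (hsep : ∀ z ∈ T, (∀ i, ℓ i z = 0) → z = 0) : Tendsto x atTop (𝓝 u) := by
  by_contra hnot
  obtain ⟨ε, hε, hfreq⟩ : ∃ ε > 0, ∃ᶠ k in atTop, ε ≤ ‖x k - u‖ := by
    simp only [Metric.tendsto_nhds, not_forall] at hnot
    obtain ⟨ε, hε, h⟩ := hnot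
    refine ⟨ε, hε, (not_eventually.1 h).mono fun k hk => ?_⟩
    rwa [dist_eq_norm, not_lt] at hk
  obtain ⟨R, hR⟩ := hJ.coercive (J u + 1)
  obtain ⟨δ, hδ, hgap⟩ := hJ.gap R ε hε
  have hη : 0 < min 1 δ := lt_min one_pos hδ
  have hev := hx (J u + min 1 δ) (by linarith)
  obtain ⟨ψ, hψ, hψ'⟩ := extraction_of_frequently_atTop (hfreq.and_eventually hev)
  -- The mean of the two energies is at most J u + δ/2, and the gap removes δ.
  have hmid : ∀ k, J ((1 / 2 : ℝ) • (x (ψ k) + u)) ≤ J u - δ / 2 := fun k => by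
    obtain ⟨h1, h2⟩ := hψ' k
    have h3 := hgap (x (ψ k)) u (hR _ (h2.trans (by gcongr; exact min_le_left _ _)))
      (hR _ (by linarith)) h1
    have := min_le_right 1 δ
    linarith
  set y : ℕ → X × X := fun k => (x (ψ k), g (ψ k)) with hy
  -- The pair (z, z') acts as a joint weak limit of `x` and `g`: by `key` it inherits every closed
  -- convex condition that holds along a tail.
  obtain ⟨⟨z, z'⟩, hz⟩ := hJ.prod.nonempty_iInter
    (C := fun k => closure (convexHull ℝ (y '' Set.Ici k)))
    (fun i j hij => closure_mono (convexHull_mono (Set.image_mono (Set.Ici_subset_Ici.2 hij))))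
    (fun _ => isClosed_closure) (fun _ => (convex_convexHull ℝ _).closure)
    (c := J u + 1 + c₀) (fun k => ⟨y k, subset_closure (subset_convexHull ℝ _ ⟨k, Set.mem_Ici.2 le_rfl, rfl⟩),
      add_le_add ((hψ' k).2.trans (by gcongr; exact min_le_left _ _)) (hg _)⟩)
  rw [Set.mem_iInter] at hz
  have key : ∀ (k : ℕ) (A : Set (X × X)), IsClosed A → Convex ℝ A → (∀ j, k ≤ j → y j ∈ A) →
      (z, z') ∈ A := fun k A hA hA' h =>
    closure_minimal (convexHull_min (by rintro _ ⟨j, hj, rfl⟩; exact h j hj) hA') hA (hz k)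
  have hzT : z ∈ T := key 0 (Prod.fst ⁻¹' T) (hTcl.preimage continuous_fst)
    (T.convex.linear_preimage (LinearMap.fst ℝ X X)) (fun j _ => hxT _)
  have hzS' : z' ∈ S := key 0 (Prod.snd ⁻¹' S) (hScl.preimage continuous_snd)
    (S.convex.linear_preimage (LinearMap.snd ℝ X X)) (fun j _ => hgS _)
  have hzz : z - z' = 0 := by
    refine hsep _ (sub_mem hzT (hST hzS')) fun i => ?_
    refine abs_eq_zero.1 (le_antisymm (le_of_forall_pos_le_add fun η hη => ?_) (abs_nonneg _))
    have h1 := ((hℓ i).comp hψ.tendsto_atTop).eventually (Metric.ball_mem_nhds 0 hη)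
    obtain ⟨k, hk⟩ := eventually_atTop.1 h1
    rw [zero_add]
    let L : X × X →L[ℝ] ℝ :=
      (ℓ i).comp (ContinuousLinearMap.fst ℝ X X - ContinuousLinearMap.snd ℝ X X)
    have h2 := key k (L ⁻¹' Metric.closedBall 0 η) (Metric.isClosed_closedBall.preimage L.continuous)
      ((convex_closedBall _ _).linear_preimage L.toLinearMap) (fun j hj => by
        simpa [L, y] using (Metric.mem_ball.1 (hk j hj)).le)
    simpa [L] using h2
  have hzS : z ∈ S := by rw [sub_eq_zero.1 hzz]; exact hzS'
  -- The bound `hmid` is a closed convex condition on the first coordinate, so it passes to z. As (z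
  -- + u)/2 is in `S`, this contradicts the minimality of `u`.
  have h3 : J ((1 / 2 : ℝ) • (z + u)) ≤ J u - δ / 2 := by
    have hc : ConvexOn ℝ Set.univ (fun w : X × X => J ((1 / 2 : ℝ) • (w.1 + u))) := by
      refine ⟨convex_univ, fun a _ b _ s t hs ht hst => ?_⟩
      have := hJ.convexOn.2 (Set.mem_univ ((1 / 2 : ℝ) • (a.1 + u)))
        (Set.mem_univ ((1 / 2 : ℝ) • (b.1 + u))) hs ht hst
      refine le_of_eq_of_le (congrArg J ?_) this
      have hu' : u = s • u + t • u := by rw [← add_smul, hst, one_smul]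
      simp only [Prod.fst_add, Prod.smul_fst]
      conv_lhs => rw [hu']
      module
    refine key 0 {w | J ((1 / 2 : ℝ) • (w.1 + u)) ≤ J u - δ / 2} (isClosed_le ?_ continuous_const)
      ?_ (fun j _ => hmid j)
    · exact hJ.continuous.comp (by fun_prop)
    · simpa using hc.convex_le (J u - δ / 2)
  have := hu _ (S.smul_mem (1 / 2 : ℝ) (S.add_mem hzS huS))
  linarith

end IsUnifConvexFunctional

/-! ### Pointwise convexity inequalities for |·|^p. -/

section Pointwise

theorem abs_midpoint_rpow_lt {p : ℝ} (hp : 1 < p) {a b : ℝ} (hab : a ≠ b) :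
    |(a + b) / 2| ^ p < (|a| ^ p + |b| ^ p) / 2 := by
  have hp0 : 0 < p := by linarith
  have h1 : |(a + b) / 2| ≤ (|a| + |b|) / 2 := by
    rw [abs_div, abs_two]; gcongr; exact abs_add_le a b
  by_cases h : |a| = |b|
  -- Strict convexity of t^p on [0, ∞) says nothing when |a| = |b|; here the midpoint is 0.
  · obtain rfl : a = -b := (abs_eq_abs.1 h).resolve_left hab
    have hb : b ≠ 0 := by rintro rfl; simp at hab
    have : 0 < |b| ^ p := Real.rpow_pos_of_pos (abs_pos.2 hb) p
    simp only [neg_add_cancel, zero_div, abs_zero, Real.zero_rpow hp0.ne', abs_neg]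
    linarith
  · have h2 := (strictConvexOn_rpow hp).2 (abs_nonneg a) (abs_nonneg b) h
      (show (0 : ℝ) < 1 / 2 by norm_num) (show (0 : ℝ) < 1 / 2 by norm_num) (by norm_num)
    simp only [smul_eq_mul] at h2
    calc |(a + b) / 2| ^ p ≤ ((|a| + |b|) / 2) ^ p := by gcongr
      _ = (1 / 2 * |a| + 1 / 2 * |b|) ^ p := by congr 1; ring
      _ < _ := h2
      _ = _ := by ring

theorem abs_midpoint_rpow_le {p : ℝ} (hp : 1 < p) (a b : ℝ) :
    |(a + b) / 2| ^ p ≤ (|a| ^ p + |b| ^ p) / 2 := by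
  rcases eq_or_ne a b with rfl | h
  · simp
  · exact (abs_midpoint_rpow_lt hp h).le

/-- Quantitative strict convexity of `|·| ^ p`. -/
theorem exists_abs_sub_rpow_le {p : ℝ} (hp : 1 < p) {η : ℝ} (hη : 0 < η) :
    ∃ C : ℝ, 0 < C ∧ ∀ a b : ℝ, |a - b| ^ p ≤
      η * (|a| ^ p + |b| ^ p) + C * ((|a| ^ p + |b| ^ p) / 2 - |(a + b) / 2| ^ p) := by
  have hp0 : 0 < p := by linarith
  -- Every term is homogeneous of degree p, so the unit sphere of the sup norm suffices.
  suffices H : ∃ C : ℝ, 0 < C ∧ ∀ z : ℝ × ℝ, ‖z‖ = 1 → |z.1 - z.2| ^ p ≤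
      η * (|z.1| ^ p + |z.2| ^ p) + C * ((|z.1| ^ p + |z.2| ^ p) / 2 - |(z.1 + z.2) / 2| ^ p) by
    obtain ⟨C, hC, h⟩ := H
    refine ⟨C, hC, fun a b => ?_⟩
    rcases eq_or_ne (a, b) 0 with h0 | h0
    · obtain ⟨rfl, rfl⟩ := Prod.mk_eq_zero.1 h0
      simp [Real.zero_rpow hp0.ne']
    set t := ‖(a, b)‖ with ht
    have ht0 : 0 < t := norm_pos_iff.2 h0
    have h1 := h (t⁻¹ • (a, b)) (by
      rw [norm_smul, norm_inv, Real.norm_of_nonneg ht0.le, ← ht, inv_mul_cancel₀ ht0.ne'])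
    have hs : ∀ x : ℝ, |t⁻¹ * x| ^ p = (t ^ p)⁻¹ * |x| ^ p := fun x => by
      rw [abs_mul, abs_of_pos (inv_pos.2 ht0), Real.mul_rpow (inv_pos.2 ht0).le (abs_nonneg _),
        Real.inv_rpow ht0.le]
    simp only [Prod.smul_fst, Prod.smul_snd, smul_eq_mul] at h1
    rw [← mul_sub, ← mul_add, mul_div_assoc, hs, hs, hs, hs] at h1
    have htp : 0 < t ^ p := Real.rpow_pos_of_pos ht0 p
    have h2 := mul_le_mul_of_nonneg_left h1 htp.le
    have h3 : t ^ p * (t ^ p)⁻¹ = 1 := mul_inv_cancel₀ htp.ne'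
    calc |a - b| ^ p = t ^ p * ((t ^ p)⁻¹ * |a - b| ^ p) := by rw [← mul_assoc, h3, one_mul]
      _ ≤ _ := h2
      _ = (t ^ p * (t ^ p)⁻¹) * (η * (|a| ^ p + |b| ^ p) +
          C * ((|a| ^ p + |b| ^ p) / 2 - |(a + b) / 2| ^ p)) := by ring
      _ = _ := by rw [h3, one_mul]
  have hcf : Continuous fun z : ℝ × ℝ =>
      (|z.1| ^ p + |z.2| ^ p) / 2 - |(z.1 + z.2) / 2| ^ p := by
    have : Continuous fun t : ℝ => t ^ p := Real.continuous_rpow_const hp0.le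
    fun_prop
  have hcg : Continuous fun z : ℝ × ℝ => |z.1 - z.2| ^ p := by
    have : Continuous fun t : ℝ => t ^ p := Real.continuous_rpow_const hp0.le
    fun_prop
  have hsum : ∀ z : ℝ × ℝ, ‖z‖ = 1 → 1 ≤ |z.1| ^ p + |z.2| ^ p := fun z hz => by
    rw [Prod.norm_def, Real.norm_eq_abs, Real.norm_eq_abs] at hz
    have h1 := Real.rpow_nonneg (abs_nonneg z.1) p
    have h2 := Real.rpow_nonneg (abs_nonneg z.2) p
    rcases max_choice |z.1| |z.2| with h | h <;> rw [h] at hz <;> rw [hz, Real.one_rpow] <;>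
      linarith
  have hsmall : ∀ z : ℝ × ℝ, ‖z‖ = 1 → ∀ C : ℝ, 0 < C → |z.1 - z.2| ^ p < η → |z.1 - z.2| ^ p ≤
      η * (|z.1| ^ p + |z.2| ^ p) + C * ((|z.1| ^ p + |z.2| ^ p) / 2 - |(z.1 + z.2) / 2| ^ p) := by
    intro z hz C hC h
    have h1 := mul_le_mul_of_nonneg_left (hsum z hz) hη.le
    have h2 := mul_nonneg hC.le (sub_nonneg.2 (abs_midpoint_rpow_le hp z.1 z.2))
    linarith
  -- Off `K` the η term alone suffices. On the compact set `K` the convexity defect has a positive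
  -- minimum m, and C = 2^p/m works because |z.1 − z.2| ≤ 2.
  set K : Set (ℝ × ℝ) := Metric.sphere 0 1 ∩ {z | η ≤ |z.1 - z.2| ^ p} with hK
  have hKc : IsCompact K :=
    (isCompact_sphere 0 1).inter_right (isClosed_le continuous_const hcg)
  rcases K.eq_empty_or_nonempty with hKe | hKn
  · refine ⟨1, one_pos, fun z hz => hsmall z hz 1 one_pos ?_⟩
    by_contra! hcon
    have : z ∈ K := ⟨by simpa using hz, hcon⟩
    rw [hKe] at this
    exact this
  · obtain ⟨z₀, hz₀, hmin⟩ := hKc.exists_isMinOn hKn hcf.continuousOn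
    set m := (|z₀.1| ^ p + |z₀.2| ^ p) / 2 - |(z₀.1 + z₀.2) / 2| ^ p with hm
    have hm0 : 0 < m := by
      refine sub_pos.2 (abs_midpoint_rpow_lt hp fun h => ?_)
      have h1 : η ≤ |z₀.1 - z₀.2| ^ p := hz₀.2
      rw [h, sub_self, abs_zero, Real.zero_rpow hp0.ne'] at h1
      linarith
    have hC : 0 < 2 ^ p / m := by positivity
    refine ⟨2 ^ p / m, hC, fun z hz => ?_⟩
    rcases lt_or_ge (|z.1 - z.2| ^ p) η with h | h
    · exact hsmall z hz _ hC h
    · have h1 : m ≤ (|z.1| ^ p + |z.2| ^ p) / 2 - |(z.1 + z.2) / 2| ^ p :=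
        hmin ⟨by simpa using hz, h⟩
      have h2 : |z.1 - z.2| ≤ 2 := by
        have a1 : |z.1| ≤ 1 := hz ▸ norm_fst_le z
        have a2 : |z.2| ≤ 1 := hz ▸ norm_snd_le z
        linarith [abs_sub z.1 z.2]
      have h3 := mul_le_mul_of_nonneg_left h1 hC.le
      have h4 := mul_nonneg hη.le (zero_le_one.trans (hsum z hz))
      rw [div_mul_cancel₀ _ hm0.ne'] at h3
      have h5 : |z.1 - z.2| ^ p ≤ 2 ^ p := by gcongr
      linarith

theorem abs_rpow_sub_two_mul_self {p : ℝ} (hp : 1 < p) (a : ℝ) :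
    |a| ^ (p - 2) * a * a = |a| ^ p := by
  rcases eq_or_ne a 0 with rfl | h
  · simp [Real.zero_rpow (by linarith : p ≠ 0)]
  · have h1 : |a| ^ p = |a| ^ (p - 2) * |a| ^ (2 : ℝ) := by
      rw [← Real.rpow_add (abs_pos.2 h)]; congr 1; ring
    rw [h1, Real.rpow_two, sq_abs]; ring

theorem abs_abs_rpow_sub_two_mul {p : ℝ} (hp : 1 < p) (a : ℝ) :
    |(|a| ^ (p - 2) * a)| = |a| ^ (p - 1) := by
  rcases eq_or_ne a 0 with rfl | h
  · simp [Real.zero_rpow (by linarith : p - 1 ≠ 0)]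
  · rw [abs_mul, abs_of_nonneg (Real.rpow_nonneg (abs_nonneg _) _)]
    nth_rw 2 [← Real.rpow_one |a|]
    rw [← Real.rpow_add (abs_pos.2 h)]; congr 1; ring

theorem rpow_sub_one_mul_le {p : ℝ} (hp : 1 < p) {a b : ℝ} (ha : 0 ≤ a) (hb : 0 ≤ b) :
    a ^ (p - 1) * b ≤ (1 - 1 / p) * a ^ p + b ^ p / p := by
  have hp0 : 0 < p := by linarith
  have hq : p.HolderConjugate (p / (p - 1)) := Real.HolderConjugate.conjExponent hp
  have h := Real.young_inequality_of_nonneg hb (Real.rpow_nonneg ha (p - 1)) hq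
  rw [← Real.rpow_mul ha, mul_div_cancel₀ _ (by linarith : p - 1 ≠ 0)] at h
  have h2 : a ^ p / (p / (p - 1)) = (1 - 1 / p) * a ^ p := by field_simp
  linarith [mul_comm b (a ^ (p - 1))]

/-- The graph of |·|^p/p lies above its tangents, by Young's inequality with exponents p and p/(p −
1). This makes Euler–Lagrange solutions minimizers. -/
theorem abs_rpow_tangent_le {p : ℝ} (hp : 1 < p) (a b : ℝ) :
    |a| ^ p / p + |a| ^ (p - 2) * a * (b - a) ≤ |b| ^ p / p := by
  have h1 := rpow_sub_one_mul_le hp (abs_nonneg a) (abs_nonneg b)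
  have h2 : |a| ^ (p - 2) * a * b ≤ |a| ^ (p - 1) * |b| := by
    rw [← abs_abs_rpow_sub_two_mul hp a, ← abs_mul]
    exact le_abs_self _
  have h3 := abs_rpow_sub_two_mul_self hp a
  have h4 : |a| ^ p / p = 1 / p * |a| ^ p := by ring
  rw [mul_sub, h3]
  linarith

end Pointwise

/-! ### The energy on L^p and its Euler–Lagrange equation. -/

section LpFunctional

variable {α : Type*} [MeasurableSpace α] {μ : Measure α} {p : ℝ}

theorem integrable_abs_rpow_of_memLp (hp : 1 < p) {g : α → ℝ} (hg : MemLp g (ENNReal.ofReal p) μ) :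
    Integrable (fun x => |g x| ^ p) μ := by
  have h := hg.integrable_norm_rpow (by simpa using by linarith) ENNReal.ofReal_ne_top
  rwa [ENNReal.toReal_ofReal (by linarith)] at h

theorem Lp_norm_rpow_eq (hp : 1 < p) (g : Lp ℝ (ENNReal.ofReal p) μ) :
    ‖g‖ ^ p = ∫ x, |g x| ^ p ∂μ := by
  have hp0 : 0 < p := by linarith
  rw [Lp.norm_def, (Lp.memLp g).eLpNorm_eq_integral_rpow_norm (by simpa using hp0)
    ENNReal.ofReal_ne_top, ENNReal.toReal_ofReal hp0.le]
  have h0 : 0 ≤ ∫ x, ‖g x‖ ^ p ∂μ := integral_nonneg fun x => by positivity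
  rw [ENNReal.toReal_ofReal (by positivity), ← Real.rpow_mul h0, inv_mul_cancel₀ hp0.ne',
    Real.rpow_one]
  rfl

theorem integrable_abs_rpow_mul (hp : 1 < p) {g h : α → ℝ} (hg : MemLp g (ENNReal.ofReal p) μ)
    (hh : MemLp h (ENNReal.ofReal p) μ) : Integrable (fun x => |g x| ^ (p - 2) * g x * h x) μ := by
  have h1 := ((integrable_abs_rpow_of_memLp hp hg).const_mul (1 - 1 / p)).add
    ((integrable_abs_rpow_of_memLp hp hh).div_const p)
  refine h1.mono' ?_ (.of_forall fun x => ?_)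
  · have a1 := hg.1.aemeasurable
    have a2 := hh.1.aemeasurable
    exact (((a1.abs.pow_const (p - 2)).mul a1).mul a2).aestronglyMeasurable
  · rw [Real.norm_eq_abs, abs_mul, abs_abs_rpow_sub_two_mul hp]
    exact rpow_sub_one_mul_le hp (abs_nonneg _) (abs_nonneg _)

/-- Differentiation under the integral: for |t| < 1 the derivative is dominated by p(|g| + |k|)^p.
-/
theorem hasDerivAt_norm_rpow (hp : 1 < p) (g k : Lp ℝ (ENNReal.ofReal p) μ) :
    HasDerivAt (fun t : ℝ => ‖g + t • k‖ ^ p) (∫ x, p * (|g x| ^ (p - 2) * g x * k x) ∂μ) 0 := by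
  have hp0 : 0 < p := by linarith
  have hm : ∀ t : ℝ, MemLp (fun x => g x + t * k x) (ENNReal.ofReal p) μ := fun t =>
    (Lp.memLp g).add ((Lp.memLp k).const_mul t)
  have e : (fun t : ℝ => ‖g + t • k‖ ^ p) = fun t => ∫ x, |g x + t * k x| ^ p ∂μ := by
    funext t
    rw [Lp_norm_rpow_eq hp]
    refine integral_congr_ae ?_
    filter_upwards [Lp.coeFn_add g (t • k), Lp.coeFn_smul t k] with x h1 h2
    rw [h1, Pi.add_apply, h2, Pi.smul_apply, smul_eq_mul]
  rw [e]
  have hb : MemLp (fun x => |g x| + |k x|) (ENNReal.ofReal p) μ :=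
    (Lp.memLp g).abs.add (Lp.memLp k).abs
  have main := hasDerivAt_integral_of_dominated_loc_of_deriv_le (μ := μ) (x₀ := (0 : ℝ))
    (F := fun t x => |g x + t * k x| ^ p)
    (F' := fun t x => p * |g x + t * k x| ^ (p - 2) * (g x + t * k x) * k x)
    (bound := fun x => p * (|g x| + |k x|) ^ p) (Metric.ball_mem_nhds 0 one_pos)
    (.of_forall fun t => (integrable_abs_rpow_of_memLp hp (hm t)).1)
    (integrable_abs_rpow_of_memLp hp (hm 0)) ?_ ?_ ?_ ?_
  · refine main.2.congr_deriv (integral_congr_ae (.of_forall fun x => ?_))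
    simp only [zero_mul, add_zero]; ring
  · have := ((integrable_abs_rpow_mul hp (hm 0) (Lp.memLp k)).const_mul p).1
    refine this.congr (.of_forall fun x => ?_)
    simp only; ring
  · refine .of_forall fun x t ht => ?_
    have ht' : |t| ≤ 1 := by
      rw [Metric.mem_ball, dist_zero_right] at ht; exact ht.le
    have h1 : |g x + t * k x| ≤ |g x| + |k x| := by
      refine (abs_add_le _ _).trans ?_
      rw [abs_mul]
      have := mul_le_mul_of_nonneg_right ht' (abs_nonneg (k x))
      linarith
    have h0 : 0 ≤ |g x| + |k x| := by positivity
    calc ‖p * |g x + t * k x| ^ (p - 2) * (g x + t * k x) * k x‖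
        = p * (|g x + t * k x| ^ (p - 1) * |k x|) := by
          rw [← abs_abs_rpow_sub_two_mul hp, Real.norm_eq_abs, ← abs_mul, mul_assoc, mul_assoc,
            abs_mul, abs_of_pos hp0, mul_assoc]
      _ ≤ p * ((|g x| + |k x|) ^ (p - 1) * (|g x| + |k x|)) := by
          have : 0 ≤ p - 1 := by linarith
          gcongr
          linarith [abs_nonneg (g x)]
      _ = p * (|g x| + |k x|) ^ p := by
          rcases h0.eq_or_lt with h | h
          · rw [← h]; simp [Real.zero_rpow hp0.ne']
          · nth_rw 2 [← Real.rpow_one (|g x| + |k x|)]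
            rw [← Real.rpow_add h]; congr 2; ring
  · refine ((integrable_abs_rpow_of_memLp hp hb).const_mul p).congr (.of_forall fun x => ?_)
    simp only
    rw [abs_of_nonneg (by positivity : 0 ≤ |g x| + |k x|)]
  · refine .of_forall fun x t _ => ?_
    have h1 : HasDerivAt (fun t : ℝ => g x + t * k x) (k x) t := by
      simpa using ((hasDerivAt_id t).mul_const (k x)).const_add (g x)
    exact (hasDerivAt_abs_rpow (g x + t * k x) hp).comp t h1

theorem Lp_norm_sub_rpow_le (hp : 1 < p) {η C : ℝ} (h : ∀ a b : ℝ, |a - b| ^ p ≤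
      η * (|a| ^ p + |b| ^ p) + C * ((|a| ^ p + |b| ^ p) / 2 - |(a + b) / 2| ^ p))
    (g k : Lp ℝ (ENNReal.ofReal p) μ) : ‖g - k‖ ^ p ≤ η * (‖g‖ ^ p + ‖k‖ ^ p) +
      C * ((‖g‖ ^ p + ‖k‖ ^ p) / 2 - ‖(1 / 2 : ℝ) • (g + k)‖ ^ p) := by
  have i1 := integrable_abs_rpow_of_memLp hp (Lp.memLp g)
  have i2 := integrable_abs_rpow_of_memLp hp (Lp.memLp k)
  have i3 := integrable_abs_rpow_of_memLp hp (Lp.memLp (g - k))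
  have i4 := integrable_abs_rpow_of_memLp hp (Lp.memLp ((1 / 2 : ℝ) • (g + k)))
  simp only [Lp_norm_rpow_eq hp]
  have i5 : Integrable (fun x => |g x| ^ p + |k x| ^ p) μ := i1.add i2
  have i6 : Integrable (fun x => (|g x| ^ p + |k x| ^ p) / 2 -
    |((1 / 2 : ℝ) • (g + k) : Lp ℝ (ENNReal.ofReal p) μ) x| ^ p) μ := (i5.div_const 2).sub i4
  rw [← integral_add i1 i2, ← integral_const_mul, ← integral_div, ← integral_sub
    (i5.div_const 2) i4, ← integral_const_mul, ← integral_add (i5.const_mul η) (i6.const_mul C)]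
  refine integral_mono_ae i3 ((i5.const_mul η).add (i6.const_mul C)) ?_
  filter_upwards [Lp.coeFn_sub g k, Lp.coeFn_smul (1 / 2 : ℝ) (g + k), Lp.coeFn_add g k]
    with x h1 h2 h3
  have h4 : ((1 / 2 : ℝ) • (g + k) : Lp ℝ (ENNReal.ofReal p) μ) x = (g x + k x) / 2 := by
    rw [h2, Pi.smul_apply, h3, Pi.add_apply, smul_eq_mul]; ring
  simp only [h1, h4, Pi.sub_apply]
  exact h _ _

variable [Fact (1 ≤ ENNReal.ofReal p)]

/-- The functional `‖g‖ ^ p / p - F g` on `L^p`. -/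
noncomputable def energy (F : Lp ℝ (ENNReal.ofReal p) μ →L[ℝ] ℝ) (g : Lp ℝ (ENNReal.ofReal p) μ) :
    ℝ := ‖g‖ ^ p / p - F g

/-- The energy is at least ‖g‖(‖g‖^(p−1)/p − ‖F‖), which tends to infinity with ‖g‖ as p > 1. -/
theorem exists_energy_growth (hp : 1 < p) (F : Lp ℝ (ENNReal.ofReal p) μ →L[ℝ] ℝ) (c : ℝ) :
    ∃ R : ℝ, ∀ g, energy F g ≤ c → ‖g‖ ≤ R := by
  have h1 : Tendsto (fun t : ℝ => t ^ (p - 1) / p - ‖F‖) atTop atTop :=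
    tendsto_atTop_add_const_right _ _
      ((tendsto_rpow_atTop (by linarith : 0 < p - 1)).atTop_div_const (by linarith))
  have h2 := tendsto_id.atTop_mul_atTop₀ h1
  obtain ⟨R, hR⟩ := eventually_atTop.1 ((h2.eventually_gt_atTop c).and (eventually_gt_atTop 0))
  refine ⟨R, fun g hg => ?_⟩
  by_contra! hlt
  obtain ⟨h3, h0⟩ := hR _ hlt.le
  have h4 : F g ≤ ‖F‖ * ‖g‖ := (le_abs_self _).trans (F.le_opNorm g)
  have h5 : ‖g‖ ^ p = ‖g‖ * ‖g‖ ^ (p - 1) := by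
    nth_rw 2 [← Real.rpow_one ‖g‖]
    rw [← Real.rpow_add h0]; congr 1; ring
  simp only [id] at h3
  rw [energy, h5] at hg
  have : ‖g‖ * (‖g‖ ^ (p - 1) / p - ‖F‖) = ‖g‖ * ‖g‖ ^ (p - 1) / p - ‖F‖ * ‖g‖ := by ring
  linarith

theorem isUnifConvexFunctional_energy (hp : 1 < p) (F : Lp ℝ (ENNReal.ofReal p) μ →L[ℝ] ℝ) :
    IsUnifConvexFunctional (energy F) where
  continuous := by
    have : Continuous fun t : ℝ => t ^ p := Real.continuous_rpow_const (by linarith)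
    unfold energy
    fun_prop
  convexOn := by
    have h1 : ConvexOn ℝ Set.univ (fun g : Lp ℝ (ENNReal.ofReal p) μ => ‖g‖ ^ p) := by
      refine ⟨convex_univ, fun x _ y _ a b ha hb hab => ?_⟩
      have h2 := (convexOn_rpow hp.le).2 (norm_nonneg x) (norm_nonneg y) ha hb hab
      refine le_trans ?_ h2
      have h3 : ‖a • x + b • y‖ ≤ a • ‖x‖ + b • ‖y‖ := by
        refine (norm_add_le _ _).trans ?_
        rw [norm_smul_of_nonneg ha, norm_smul_of_nonneg hb, smul_eq_mul, smul_eq_mul]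
      exact Real.rpow_le_rpow (norm_nonneg _) h3 (by linarith)
    have h2 := (h1.smul (show 0 ≤ 1 / p by positivity)).sub
      (F.toLinearMap.concaveOn convex_univ)
    refine h2.congr fun g _ => ?_
    simp [energy]; ring
  gap := by
    intro R ε hε
    have hp0 : 0 < p := by linarith
    have hεp : 0 < ε ^ p := Real.rpow_pos_of_pos hε p
    set R' := max R 0 with hR'
    have hRp : 0 ≤ R' ^ p := Real.rpow_nonneg (le_max_right _ _) _
    -- With this η the first term is at most ε^p/2 on the ball of radius R', so the convexity defect
    -- of ‖·‖^p is at least ε^p/(2C); dividing by p gives δ.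
    obtain ⟨C, hC, h⟩ := exists_abs_sub_rpow_le hp
      (show 0 < ε ^ p / (4 * (R' ^ p + 1)) by positivity)
    refine ⟨ε ^ p / (2 * C * p), by positivity, fun x y hx hy hxy => ?_⟩
    have h1 := Lp_norm_sub_rpow_le hp h x y
    have hx' : ‖x‖ ^ p ≤ R' ^ p := by gcongr; exact hx.trans (le_max_left _ _)
    have hy' : ‖y‖ ^ p ≤ R' ^ p := by gcongr; exact hy.trans (le_max_left _ _)
    have h2 : ε ^ p ≤ ‖x - y‖ ^ p := by gcongr
    have h3 : ε ^ p / (4 * (R' ^ p + 1)) * (‖x‖ ^ p + ‖y‖ ^ p) ≤ ε ^ p / 2 := by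
      calc _ ≤ ε ^ p / (4 * (R' ^ p + 1)) * (2 * (R' ^ p + 1)) := by gcongr; linarith
        _ = _ := by field_simp; ring
    have h4 : ε ^ p / (2 * C) ≤
        (‖x‖ ^ p + ‖y‖ ^ p) / 2 - ‖(1 / 2 : ℝ) • (x + y)‖ ^ p := by
      rw [div_le_iff₀ (by positivity)]; linarith
    have h5 : ε ^ p / (2 * C * p) = ε ^ p / (2 * C) / p := by rw [div_div]
    have h6 : F ((1 / 2 : ℝ) • (x + y)) = (F x + F y) / 2 := by
      rw [map_smul, map_add, smul_eq_mul]; ring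
    have h7 := div_le_div_of_nonneg_right h4 hp0.le
    rw [energy, energy, energy, h5, h6]
    have h8 : ((‖x‖ ^ p + ‖y‖ ^ p) / 2 - ‖(1 / 2 : ℝ) • (x + y)‖ ^ p) / p =
      (‖x‖ ^ p / p + ‖y‖ ^ p / p) / 2 - ‖(1 / 2 : ℝ) • (x + y)‖ ^ p / p := by ring
    linarith
  coercive := exists_energy_growth hp F
  bddBelow := by
    obtain ⟨R, hR⟩ := exists_energy_growth hp F 0
    refine ⟨-(‖F‖ * max R 0), fun g => ?_⟩
    have h0 : 0 ≤ ‖F‖ * max R 0 := mul_nonneg (norm_nonneg _) (le_max_right _ _)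
    rcases le_or_gt (energy F g) 0 with h | h
    · have h1 : F g ≤ ‖F‖ * max R 0 := ((le_abs_self _).trans (F.le_opNorm g)).trans (by
        gcongr; exact (hR g h).trans (le_max_left _ _))
      have h2 : 0 ≤ ‖g‖ ^ p / p := by positivity
      rw [energy]
      linarith
    · linarith

/-- Euler–Lagrange characterisation of the minimizers of `energy F` on a subspace. -/
theorem energy_isMin_iff (hp : 1 < p) (F : Lp ℝ (ENNReal.ofReal p) μ →L[ℝ] ℝ)
    {S : Submodule ℝ (Lp ℝ (ENNReal.ofReal p) μ)} {g : Lp ℝ (ENNReal.ofReal p) μ} (hg : g ∈ S) :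
    (∀ z ∈ S, energy F g ≤ energy F z) ↔
      ∀ k ∈ S, ∫ x, |g x| ^ (p - 2) * g x * k x ∂μ = F k := by
  have hp0 : 0 < p := by linarith
  constructor
  · intro h k hk
    have h1 : HasDerivAt (fun t : ℝ => energy F (g + t • k))
        ((∫ x, p * (|g x| ^ (p - 2) * g x * k x) ∂μ) / p - F k) 0 := by
      refine ((hasDerivAt_norm_rpow hp g k).div_const p).sub ?_
      have : HasDerivAt (fun t : ℝ => F g + t * F k) (F k) 0 := by
        simpa using ((hasDerivAt_id (0 : ℝ)).mul_const (F k)).const_add (F g)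
      simpa using this
    have h2 : IsLocalMin (fun t : ℝ => energy F (g + t • k)) 0 := .of_forall fun t => by
      simpa using h _ (S.add_mem hg (S.smul_mem t hk))
    have h3 := h2.hasDerivAt_eq_zero h1
    rw [integral_const_mul, mul_div_cancel_left₀ _ hp0.ne'] at h3
    linarith
  · intro h z hz
    have h1 := h (z - g) (S.sub_mem hz hg)
    have i1 := (integrable_abs_rpow_of_memLp hp (Lp.memLp g)).div_const p
    have i2 := (integrable_abs_rpow_of_memLp hp (Lp.memLp z)).div_const p
    have i3 := integrable_abs_rpow_mul hp (Lp.memLp g) (Lp.memLp (z - g))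
    have h2 : (∫ x, |g x| ^ p / p ∂μ) + ∫ x, |g x| ^ (p - 2) * g x * (z - g) x ∂μ ≤
        ∫ x, |z x| ^ p / p ∂μ := by
      rw [← integral_add i1 i3]
      refine integral_mono_ae (i1.add i3) i2 ?_
      filter_upwards [Lp.coeFn_sub z g] with x hx
      simp only [hx, Pi.sub_apply]
      exact abs_rpow_tangent_le hp _ _
    rw [integral_div, integral_div, ← Lp_norm_rpow_eq hp, ← Lp_norm_rpow_eq hp, h1, map_sub] at h2
    rw [energy, energy]
    linarith

end LpFunctional

/-! ### Difference quotients and the fractional Poincaré inequality. -/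

section Quot

variable {n : ℕ} {s p : ℝ} {u v : E n → ℝ}

theorem quot_add : quot s p (u + v) = quot s p u + quot s p v := by
  funext z; simp only [quot, Pi.add_apply]; ring

theorem quot_sub : quot s p (u - v) = quot s p u - quot s p v := by
  funext z; simp only [quot, Pi.sub_apply]; ring

theorem quot_smul (c : ℝ) : quot s p (c • u) = c • quot s p u := by
  funext z; simp only [quot, Pi.smul_apply, smul_eq_mul]; ring

theorem ae_prod_and {P : E n → Prop} (h : ∀ᵐ x, P x) :
    ∀ᵐ z : E n × E n, P z.1 ∧ P z.2 := by
  rw [Measure.volume_eq_prod]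
  exact (Measure.quasiMeasurePreserving_fst.ae h).and (Measure.quasiMeasurePreserving_snd.ae h)

theorem quot_congr (h : u =ᵐ[volume] v) : quot s p u =ᵐ[volume] quot s p v := by
  filter_upwards [ae_prod_and h] with z hz
  rw [quot, quot, hz.1, hz.2]

theorem aestronglyMeasurable_quot (hu : AEStronglyMeasurable u volume) :
    AEStronglyMeasurable (quot s p u) (volume : Measure (E n × E n)) := by
  have h1 : AEMeasurable (fun z : E n × E n => u z.1) volume := by
    rw [Measure.volume_eq_prod]
    exact hu.aemeasurable.comp_quasiMeasurePreserving Measure.quasiMeasurePreserving_fst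
  have h2 : AEMeasurable (fun z : E n × E n => u z.2) volume := by
    rw [Measure.volume_eq_prod]
    exact hu.aemeasurable.comp_quasiMeasurePreserving Measure.quasiMeasurePreserving_snd
  have h3 : AEMeasurable (fun z : E n × E n => ‖z.1 - z.2‖ ^ ((n : ℝ) / p + s)) volume :=
    (by fun_prop : Measurable fun z : E n × E n => ‖z.1 - z.2‖).pow_const _ |>.aemeasurable
  exact ((h1.sub h2).div h3).aestronglyMeasurable

theorem mem_W_congr (h : u =ᵐ[volume] v) (hu : u ∈ W n s p) : v ∈ W n s p :=
  ⟨hu.1.ae_eq h, hu.2.ae_eq (quot_congr h)⟩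

theorem eLpNorm_rpow_eq {α : Type*} [MeasurableSpace α] {μ : Measure α} (hp : 1 < p) (g : α → ℝ) :
    eLpNorm g (ENNReal.ofReal p) μ ^ p = ∫⁻ x, ‖g x‖ₑ ^ p ∂μ := by
  have hp0 : 0 < p := by linarith
  rw [eLpNorm_eq_lintegral_rpow_enorm_toReal (by simpa using hp0) ENNReal.ofReal_ne_top,
    ENNReal.toReal_ofReal hp0.le, ← ENNReal.rpow_mul, one_div, inv_mul_cancel₀ hp0.ne',
    ENNReal.rpow_one]

theorem eLpNorm_le_sobolevNorm (hp : 1 < p) (u : E n → ℝ) :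
    eLpNorm u (ENNReal.ofReal p) volume ≤ sobolevNorm s p u := by
  rw [sobolevNorm_eq hp, ← ENNReal.rpow_le_rpow_iff (z := p) (by linarith), ← ENNReal.rpow_mul,
    one_div, inv_mul_cancel₀ (by linarith), ENNReal.rpow_one]
  exact le_self_add

theorem eLpNorm_quot_le_sobolevNorm (hp : 1 < p) (u : E n → ℝ) :
    eLpNorm (quot s p u) (ENNReal.ofReal p) volume ≤ sobolevNorm s p u := by
  rw [sobolevNorm_eq hp, ← ENNReal.rpow_le_rpow_iff (z := p) (by linarith), ← ENNReal.rpow_mul,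
    one_div, inv_mul_cancel₀ (by linarith), ENNReal.rpow_one]
  exact le_add_self

theorem sobolevNorm_le_add (hp : 1 < p) (u : E n → ℝ) :
    sobolevNorm s p u ≤ eLpNorm u (ENNReal.ofReal p) volume +
      eLpNorm (quot s p u) (ENNReal.ofReal p) volume := by
  rw [sobolevNorm_eq hp]
  exact ENNReal.rpow_add_rpow_le_add _ _ hp.le

theorem sobolevNorm_congr (hp : 1 < p) (h : u =ᵐ[volume] v) :
    sobolevNorm s p u = sobolevNorm s p v := by
  rw [sobolevNorm_eq hp, sobolevNorm_eq hp, eLpNorm_congr_ae h, eLpNorm_congr_ae (quot_congr h)]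

theorem sobolevNorm_eq_zero_of_ae (hp : 1 < p) (h : u =ᵐ[volume] 0) : sobolevNorm s p u = 0 := by
  rw [sobolevNorm_congr hp h, sobolevNorm_zero hp]

theorem gagliardo_eq (hp : 1 < p) (u : E n → ℝ) :
    gagliardo s p u = eLpNorm (quot s p u) (ENNReal.ofReal p) volume ^ p := by
  rw [eLpNorm_rpow_eq hp, gagliardo]
  refine lintegral_congr fun z => ?_
  rw [← ofReal_norm, ENNReal.ofReal_rpow_of_nonneg (norm_nonneg _) (by linarith),
    Real.norm_eq_abs, quot, abs_div, abs_of_nonneg (Real.rpow_nonneg (norm_nonneg _) _),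
    Real.div_rpow (abs_nonneg _) (Real.rpow_nonneg (norm_nonneg _) _),
    ← Real.rpow_mul (norm_nonneg _)]
  congr 3
  field_simp

/-- Fractional Poincaré inequality. -/
theorem exists_poincare (hn : 1 ≤ n) (hs : 0 < s) (hp : 1 < p) {D : Set (E n)}
    (hD : Bornology.IsBounded D) : ∃ C : ℝ≥0, ∀ u : E n → ℝ, AEStronglyMeasurable u volume →
      (∀ᵐ x, x ∉ D → u x = 0) → eLpNorm u (ENNReal.ofReal p) volume ≤
        C * eLpNorm (quot s p u) (ENNReal.ofReal p) volume := by
  have hp0 : 0 < p := by linarith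
  obtain ⟨R, hR0, hR⟩ := hD.subset_ball_lt 0 0
  -- `B` is a ball disjoint from D ⊆ ball(0, R). For x in D and almost every y in `B` one has u(y) =
  -- 0 and 0 < |x − y| ≤ 6R, hence |u(x)| ≤ κ |quot(x, y)|; this is raised to the power p and
  -- integrated over `B`.
  let c : E n := EuclideanSpace.single ⟨0, hn⟩ (3 * R)
  have hc : ‖c‖ = 3 * R := by
    simp only [c, PiLp.norm_single, Real.norm_eq_abs]
    exact abs_of_pos (by linarith)
  set B : Set (E n) := Metric.ball c R with hB
  have hB0 : volume B ≠ 0 := (Metric.measure_ball_pos volume c hR0).ne'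
  have hBt : volume B ≠ ⊤ := measure_ball_lt_top.ne
  have hBn : ∀ y ∈ B, 2 * R < ‖y‖ ∧ ‖y‖ < 4 * R := fun y hy => by
    rw [hB, Metric.mem_ball, dist_eq_norm] at hy
    have h1 := norm_sub_norm_le c y
    have h2 := norm_sub_norm_le y c
    rw [norm_sub_rev] at h1
    constructor <;> linarith
  set κ : ℝ := (6 * R) ^ ((n : ℝ) / p + s) with hκ
  set K : ℝ≥0∞ := ENNReal.ofReal κ ^ p / volume B with hK
  have hKt : K ≠ ⊤ := ENNReal.div_ne_top (by simp [hp0.le]) hB0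
  refine ⟨(K ^ (1 / p)).toNNReal, fun u hum hu => ?_⟩
  rw [ENNReal.coe_toNNReal (by simp [hKt, hp0.le]),
    ← ENNReal.rpow_le_rpow_iff (z := p) hp0, ENNReal.mul_rpow_of_nonneg _ _ hp0.le,
    ← ENNReal.rpow_mul, one_div, inv_mul_cancel₀ hp0.ne', ENNReal.rpow_one, eLpNorm_rpow_eq hp,
    eLpNorm_rpow_eq hp]
  have hqm := aestronglyMeasurable_quot (s := s) (p := p) hum
  rw [Measure.volume_eq_prod] at hqm ⊢
  have hqm' : AEMeasurable (fun z => ‖quot s p u z‖ₑ ^ p)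
      ((volume : Measure (E n)).prod volume) := hqm.enorm.pow_const p
  rw [lintegral_prod _ hqm', ← lintegral_const_mul' _ _ hKt]
  refine lintegral_mono_ae ?_
  filter_upwards [hu] with x hx
  by_cases hxD : x ∈ D
  · have hxn : ‖x‖ < R := by simpa using hR hxD
    have h1 : ‖u x‖ₑ ^ p * volume B ≤
        ENNReal.ofReal κ ^ p * ∫⁻ y, ‖quot s p u (x, y)‖ₑ ^ p := by
      rw [← setLIntegral_const, ← lintegral_const_mul' _ _ (by simp [hp0.le])]
      refine le_trans (lintegral_mono_ae ?_) (setLIntegral_le_lintegral B _)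
      filter_upwards [ae_restrict_mem measurableSet_ball, ae_restrict_of_ae hu] with y hyB hy
      have hyn := hBn y hyB
      have hyD : y ∉ D := fun h => by
        have : ‖y‖ < R := by simpa using hR h
        linarith
      rw [← ENNReal.mul_rpow_of_nonneg _ _ hp0.le]
      gcongr
      have hpos : 0 < ‖x - y‖ := by
        have := norm_sub_norm_le y x
        rw [norm_sub_rev] at this
        linarith
      have hle : ‖x - y‖ ≤ 6 * R := by
        have := norm_sub_le x y
        linarith
      have hex : 0 ≤ (n : ℝ) / p + s := by positivity
      have hle' : ‖x - y‖ ^ ((n : ℝ) / p + s) ≤ κ :=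
        Real.rpow_le_rpow hpos.le hle hex
      have hpos' : 0 < ‖x - y‖ ^ ((n : ℝ) / p + s) := by positivity
      rw [← ofReal_norm, ← ofReal_norm, ← ENNReal.ofReal_mul (by positivity)]
      refine ENNReal.ofReal_le_ofReal ?_
      rw [quot, hy hyD, sub_zero, norm_div, Real.norm_of_nonneg hpos'.le, mul_div_assoc',
        le_div_iff₀ hpos', mul_comm κ]
      gcongr
    rw [hK, ENNReal.div_eq_inv_mul, mul_assoc, ← ENNReal.div_eq_inv_mul,
      ENNReal.le_div_iff_mul_le (Or.inl hB0) (Or.inl hBt)]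
    exact h1
  · rw [hx hxD]
    simp [hp0]

end Quot

/-! ### The function spaces as closed subspaces of L^p(ℝⁿ × ℝⁿ). -/

section QuotLp

variable {n : ℕ} {s p : ℝ}

/-- The difference quotient as a linear map from `W^{s,p}(ℝⁿ)` to `L^p(ℝⁿ × ℝⁿ)`. -/
noncomputable def quotLp (n : ℕ) (s p : ℝ) :
    W n s p →ₗ[ℝ] Lp ℝ (ENNReal.ofReal p) (volume : Measure (E n × E n)) where
  toFun u := MemLp.toLp (quot s p u) u.2.2
  map_add' u v := by
    rw [← MemLp.toLp_add]
    exact MemLp.toLp_congr _ _ (.of_forall fun z => by rw [Submodule.coe_add, quot_add])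
  map_smul' c u := by
    rw [RingHom.id_apply, ← MemLp.toLp_const_smul]
    exact MemLp.toLp_congr _ _ (.of_forall fun z => by rw [Submodule.coe_smul, quot_smul])

theorem coeFn_quotLp (u : W n s p) : quotLp n s p u =ᵐ[volume] quot s p (u : E n → ℝ) :=
  MemLp.coeFn_toLp u.2.2

theorem enorm_quotLp (u : W n s p) :
    ‖quotLp n s p u‖ₑ = eLpNorm (quot s p (u : E n → ℝ)) (ENNReal.ofReal p) volume :=
  Lp.enorm_toLp u.2.2

/-- The image in `L^p(ℝⁿ × ℝⁿ)` of a space of functions under `quotLp`. -/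
noncomputable def quotImage (s p : ℝ) (Y : Submodule ℝ (E n → ℝ)) :
    Submodule ℝ (Lp ℝ (ENNReal.ofReal p) (volume : Measure (E n × E n))) :=
  (Y.comap (W n s p).subtype).map (quotLp n s p)

theorem mem_quotImage {Y : Submodule ℝ (E n → ℝ)}
    {G : Lp ℝ (ENNReal.ofReal p) (volume : Measure (E n × E n))} :
    G ∈ quotImage s p Y ↔ ∃ u : W n s p, (u : E n → ℝ) ∈ Y ∧ quotLp n s p u = G := Iff.rfl

theorem quotLp_mem_quotImage {Y : Submodule ℝ (E n → ℝ)} {u : W n s p} (h : (u : E n → ℝ) ∈ Y) :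
    quotLp n s p u ∈ quotImage s p Y := ⟨u, h, rfl⟩

theorem quotImage_mono {Y Z : Submodule ℝ (E n → ℝ)} (h : Y ≤ Z) :
    quotImage s p Y ≤ quotImage s p Z :=
  Submodule.map_mono (Submodule.comap_mono h)

/-- `Y` is closed in `W^{s,p}(ℝⁿ)` for the norm `‖·‖_{s,p}`. -/
def SobolevClosed (s p : ℝ) (Y : Submodule ℝ (E n → ℝ)) : Prop :=
  ∀ u ∈ W n s p, (∀ ε : ℝ≥0∞, 0 < ε → ∃ v ∈ Y, v ∈ W n s p ∧ sobolevNorm s p (u - v) < ε) → u ∈ Y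

theorem W₀_le_W (hp : 1 < p) (O : Set (E n)) : W₀ s hp O ≤ W n s p := fun _ h => h.1

theorem W₀ae_le_W (O : Set (E n)) : W₀ae s p O ≤ W n s p := fun _ h => h.1

theorem sobolevClosed_W₀ (hp : 1 < p) (O : Set (E n)) : SobolevClosed s p (W₀ s hp O) := by
  refine fun u hu h => ⟨hu, fun ε hε => ?_⟩
  obtain ⟨v, hv, hvW, h1⟩ := h (ε / 2) (ENNReal.half_pos hε.ne')
  obtain ⟨φ, hφ, ht, h2⟩ := hv.2 (ε / 2) (ENNReal.half_pos hε.ne')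
  refine ⟨φ, hφ, ht, ?_⟩
  rw [← sub_add_sub_cancel u v φ]
  refine (sobolevNorm_add_le hp (sub_mem hu hvW) (sub_mem hvW hφ)).trans_lt ?_
  calc _ < ε / 2 + ε / 2 := ENNReal.add_lt_add h1 h2
    _ = ε := ENNReal.add_halves ε

theorem sobolevClosed_W₀ae (hp : 1 < p) {O : Set (E n)} (hO : IsOpen O) :
    SobolevClosed s p (W₀ae s p O) := by
  have hOm : MeasurableSet Oᶜ := hO.measurableSet.compl
  refine fun u hu h => ⟨hu, ?_⟩
  have h0 : eLpNorm u (ENNReal.ofReal p) (volume.restrict Oᶜ) = 0 := by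
    refine le_antisymm (le_of_forall_pos_le_add fun ε hε => ?_) zero_le
    obtain ⟨v, hv, hvW, h1⟩ := h ε hε
    rw [zero_add]
    have h2 : u =ᵐ[volume.restrict Oᶜ] u - v := by
      filter_upwards [ae_restrict_mem hOm, ae_restrict_of_ae hv.2] with x hx hx'
      simp [hx' hx]
    rw [eLpNorm_congr_ae h2]
    exact ((eLpNorm_mono_measure _ Measure.restrict_le_self).trans
      (eLpNorm_le_sobolevNorm hp _)).trans h1.le
  rw [eLpNorm_eq_zero_iff hu.1.1.restrict (by simpa using by linarith)] at h0
  exact (ae_restrict_iff' hOm).1 h0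

theorem W₀_le_W₀ae (hp : 1 < p) {O : Set (E n)} (hO : IsOpen O) : W₀ s hp O ≤ W₀ae s p O := by
  intro u hu
  refine sobolevClosed_W₀ae hp hO u hu.1 fun ε hε => ?_
  obtain ⟨φ, hφ, ht, h⟩ := hu.2 ε hε
  exact ⟨φ, ⟨hφ, .of_forall fun x hx => image_eq_zero_of_notMem_tsupport fun h' => hx (ht.2.2 h')⟩,
    hφ, h⟩

theorem W₀_mono (hp : 1 < p) {O O' : Set (E n)} (h : O ⊆ O') : W₀ s hp O ≤ W₀ s hp O' := by
  refine fun u hu => ⟨hu.1, fun ε hε => ?_⟩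
  obtain ⟨φ, hφ, ht, h'⟩ := hu.2 ε hε
  exact ⟨φ, hφ, ⟨ht.1, ht.2.1, ht.2.2.trans h⟩, h'⟩

theorem W₀ae_mono {O O' : Set (E n)} (h : O ⊆ O') : W₀ae s p O ≤ W₀ae s p O' := by
  refine fun u hu => ⟨hu.1, ?_⟩
  filter_upwards [hu.2] with x hx hx' using hx fun hxO => hx' (h hxO)

/-- The spaces consist of functions, not of classes; two a.e. equal functions are at distance zero,
so closedness makes membership independent of the representative. -/
theorem mem_of_ae_eq {Y : Submodule ℝ (E n → ℝ)} (hp : 1 < p) (hY : SobolevClosed s p Y)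
    (hYW : Y ≤ W n s p) {u v : E n → ℝ} (hu : u ∈ Y) (h : u =ᵐ[volume] v) : v ∈ Y := by
  refine hY v (mem_W_congr h (hYW hu)) fun ε hε => ⟨u, hu, hYW hu, ?_⟩
  rwa [sobolevNorm_eq_zero_of_ae hp]
  filter_upwards [h] with x hx
  simp [hx]

variable [Fact (1 ≤ ENNReal.ofReal p)]

/-- If the quotients converge, Poincaré makes the functions Cauchy in L^p. An a.e. convergent
subsequence then identifies the limit of the quotients as the quotient of the limit. -/
theorem isClosed_quotImage (hn : 1 ≤ n) (hs : 0 < s) (hp : 1 < p) {D : Set (E n)}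
    (hD : Bornology.IsBounded D) {Y : Submodule ℝ (E n → ℝ)} (hYD : Y ≤ W₀ae s p D)
    (hY : SobolevClosed s p Y) : 
    IsClosed (quotImage s p Y : Set (Lp ℝ (ENNReal.ofReal p) (volume : Measure (E n × E n)))) := by
  obtain ⟨C, hC⟩ := exists_poincare hn hs hp hD
  refine IsSeqClosed.isClosed fun G g hG hg => ?_
  choose u huY huG using fun k => mem_quotImage.1 (hG k)
  have hdist : ∀ i j, edist ((u i).2.1.toLp _) ((u j).2.1.toLp _) ≤ C * edist (G i) (G j) := by
    intro i j
    have h1 := hC (u i - u j) (sub_mem (u i).2 (u j).2).1.1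
      (hYD (Y.sub_mem (huY i) (huY j))).2
    rw [Lp.edist_toLp_toLp]
    refine h1.trans_eq ?_
    rw [← huG i, ← huG j, edist_eq_enorm_sub, ← map_sub, enorm_quotLp]
    rfl
  have hGc : CauchySeq G := hg.cauchySeq
  have hcau : CauchySeq fun k => (u k).2.1.toLp (u k : E n → ℝ) := by
    rw [EMetric.cauchySeq_iff] at hGc ⊢
    intro ε hε
    obtain ⟨N, hN⟩ := hGc (ε / (C + 1)) (ENNReal.div_pos hε.ne' (by simp))
    refine ⟨N, fun i hi j hj => (hdist i j).trans_lt ?_⟩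
    refine lt_of_le_of_lt (mul_le_mul_left (le_add_of_nonneg_right zero_le_one) _) ?_
    rw [mul_comm]
    exact (ENNReal.lt_div_iff_mul_lt (Or.inl (by simp)) (Or.inl (by simp))).1 (hN i hi j hj)
  obtain ⟨U, hU⟩ := cauchySeq_tendsto_of_complete hcau
  obtain ⟨ψ, hψ, hψae⟩ := (tendstoInMeasure_of_tendsto_Lp hU).exists_seq_tendsto_ae
  obtain ⟨φ, hφ, hφae⟩ := (tendstoInMeasure_of_tendsto_Lp
    (hg.comp hψ.tendsto_atTop)).exists_seq_tendsto_ae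
  have hψae' : ∀ᵐ x, Tendsto (fun i => (u (ψ i) : E n → ℝ) x) atTop (𝓝 (U x)) := by
    filter_upwards [hψae, ae_all_iff.2 fun i => MemLp.coeFn_toLp (u (ψ i)).2.1] with x h1 h2
    simpa only [h2] using h1
  have hquot : quot s p U =ᵐ[volume] g := by
    filter_upwards [ae_prod_and hψae', hφae, ae_all_iff.2 fun i => coeFn_quotLp (u i)]
      with z h1 h2 h3
    refine tendsto_nhds_unique ?_ h2
    have h4 : ∀ i, G (ψ (φ i)) z = quot s p (u (ψ (φ i))) z := fun i => by rw [← huG, h3]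
    simp only [Function.comp_apply, h4]
    exact ((h1.1.comp hφ.tendsto_atTop).sub (h1.2.comp hφ.tendsto_atTop)).div_const _
  have hUW : (U : E n → ℝ) ∈ W n s p := ⟨Lp.memLp U, (Lp.memLp g).ae_eq hquot.symm⟩
  have hgU : quotLp n s p ⟨U, hUW⟩ = g := Lp.ext ((coeFn_quotLp _).trans hquot)
  refine mem_quotImage.2 ⟨⟨U, hUW⟩, hY U hUW fun ε hε => ?_, hgU⟩
  have e1 : ∀ᶠ k in atTop, edist ((u k).2.1.toLp (u k : E n → ℝ)) U < ε / 2 :=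
    (EMetric.tendsto_nhds.1 hU) _ (ENNReal.half_pos hε.ne')
  have e2 : ∀ᶠ k in atTop, edist (G k) g < ε / 2 :=
    (EMetric.tendsto_nhds.1 hg) _ (ENNReal.half_pos hε.ne')
  obtain ⟨k, h1, h2⟩ := (e1.and e2).exists
  refine ⟨u k, huY k, (u k).2, (sobolevNorm_le_add hp _).trans_lt ?_⟩
  rw [← ENNReal.add_halves ε]
  refine ENNReal.add_lt_add ?_ ?_
  · refine lt_of_eq_of_lt ?_ h1
    rw [edist_comm, Lp.edist_def]
    refine eLpNorm_congr_ae ?_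
    filter_upwards [MemLp.coeFn_toLp (u k).2.1] with x hx
    simp [hx]
  · refine lt_of_eq_of_lt ?_ h2
    rw [edist_comm, edist_eq_enorm_sub, ← hgU, ← huG k, ← map_sub, enorm_quotLp]
    rfl

end QuotLp

/-! ### Extension of functionals from the space of functions to L^p. -/

section HahnBanach

/-- The bound makes `ℓ` vanish on the kernel of `T`, so it factors through the range of `T`, where
it is continuous and Hahn–Banach applies. -/
theorem exists_extend_of_bound {Y X : Type*} [AddCommGroup Y] [Module ℝ Y] [NormedAddCommGroup X]
    [NormedSpace ℝ X] (T : Y →ₗ[ℝ] X) (ℓ : Y →ₗ[ℝ] ℝ) {C : ℝ} (h : ∀ v, |ℓ v| ≤ C * ‖T v‖) :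
    ∃ F : X →L[ℝ] ℝ, ∀ v, F (T v) = ℓ v := by
  obtain ⟨g, hg⟩ := T.rangeRestrict.exists_rightInverse_of_surjective T.range_rangeRestrict
  have hg' : ∀ x, T (g x) = x := fun x => congrArg Subtype.val (LinearMap.congr_fun hg x)
  let F₀ : T.range →L[ℝ] ℝ := (ℓ.comp g).mkContinuous C fun x => by
    simpa [hg'] using h (g x)
  obtain ⟨F, hF, -⟩ := exists_extension_norm_eq _ F₀
  refine ⟨F, fun v => ?_⟩
  have h1 := hF ⟨T v, v, rfl⟩
  rw [h1]
  change ℓ (g _) = ℓ v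
  rw [← sub_eq_zero, ← map_sub]
  have h2 := h (g ⟨T v, v, rfl⟩ - v)
  rw [map_sub T, hg'] at h2
  simpa using h2

end HahnBanach

/-! ### Mollification in L^p: translations and averages. -/

section Translation

variable {X Z : Type*} [NormedAddCommGroup X] [NormedSpace ℝ X] [NormedAddCommGroup Z]
  [NormedSpace ℝ Z] [MeasurableSpace Z] [BorelSpace Z] {ν : Measure Z}

/-- Continuity of translations in `L^p`. -/
theorem eventually_eLpNorm_sub_translate_le [ν.IsAddRightInvariant] [IsLocallyFiniteMeasure ν]
    [ν.InnerRegularCompactLTTop] [SecondCountableTopology Z] {q : ℝ≥0∞} (hq1 : 1 ≤ q)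
    (hq : q ≠ ⊤) {G : Z → ℝ} (hG : MemLp G q ν) (T : X →L[ℝ] Z) {ε : ℝ≥0∞} (hε : 0 < ε) :
    ∀ᶠ t in 𝓝 (0 : X), eLpNorm (fun z => G z - G (z - T t)) q ν ≤ ε := by
  have : Fact (1 ≤ q) := ⟨hq1⟩
  let g : C(X, C(Z, Z)) :=
    (ContinuousMap.mk (fun a : X × Z => a.2 - T a.1) (by fun_prop)).curry
  have hgm : ∀ t, MeasurePreserving (g t) ν ν := fun t => measurePreserving_sub_right ν (T t)
  have hcont : Continuous fun t => Lp.compMeasurePreserving (g t) (hgm t) (hG.toLp G) :=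
    continuous_const.compMeasurePreservingLp g.continuous hgm hq
  have h1 := (EMetric.tendsto_nhds.1 (hcont.tendsto 0)) ε hε
  filter_upwards [h1] with t ht
  rw [Lp.toLp_compMeasurePreserving, Lp.toLp_compMeasurePreserving, edist_comm,
    Lp.edist_toLp_toLp] at ht
  refine le_trans (le_of_eq ?_) ht.le
  congr 1
  funext z
  simp [g]

end Translation

section Mollify

variable {X Z : Type*} [MeasurableSpace X] [MeasurableSpace Z] {m : Measure X} [SFinite m]
  {ν : Measure Z} [SFinite ν] {p : ℝ}

/-- Minkowski's inequality for averages. -/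
theorem eLpNorm_sub_average_le (hp : 1 < p) {ρ : X → ℝ} (hρm : Measurable ρ) (hρ0 : ∀ t, 0 ≤ ρ t)
    (hρi : Integrable ρ m) (hρ : ∫ t, ρ t ∂m = 1) {τ : X → Z → Z}
    (hτ : Measurable fun a : X × Z => τ a.1 a.2) {G : Z → ℝ} (hG : Measurable G)
    (hint : ∀ z, Integrable (fun t => ρ t * G (τ t z)) m) {η : ℝ≥0∞}
    (hη : ∀ t, ρ t ≠ 0 → eLpNorm (fun z => G z - G (τ t z)) (ENNReal.ofReal p) ν ≤ η) :
    eLpNorm (fun z => G z - ∫ t, ρ t * G (τ t z) ∂m) (ENNReal.ofReal p) ν ≤ η := by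
  have hp0 : 0 < p := by linarith
  have hmass : ∫⁻ t, ENNReal.ofReal (ρ t) ∂m = 1 := by
    rw [← ofReal_integral_eq_lintegral_ofReal hρi (.of_forall hρ0), hρ, ENNReal.ofReal_one]
  have hρe : Measurable fun t => ENNReal.ofReal (ρ t) := hρm.ennreal_ofReal
  -- Under the probability measure ρ dm, Jensen's inequality is the comparison of the L¹ and L^p
  -- norms; Tonelli's theorem then exchanges the integrals.
  set P : Measure X := m.withDensity fun t => ENNReal.ofReal (ρ t) with hP
  have : IsProbabilityMeasure P :=
    ⟨by rw [hP, withDensity_apply _ MeasurableSet.univ, Measure.restrict_univ, hmass]⟩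
  have hdm : Measurable fun a : X × Z => G a.2 - G (τ a.1 a.2) :=
    (hG.comp measurable_snd).sub (hG.comp hτ)
  have hpt : ∀ z, ‖G z - ∫ t, ρ t * G (τ t z) ∂m‖ₑ ^ p ≤
      ∫⁻ t, ENNReal.ofReal (ρ t) * ‖G z - G (τ t z)‖ₑ ^ p ∂m := by
    intro z
    have hz : Measurable fun t => G z - G (τ t z) := hdm.comp (measurable_id.prodMk measurable_const)
    have e1 : G z - ∫ t, ρ t * G (τ t z) ∂m = ∫ t, ρ t * (G z - G (τ t z)) ∂m := by
      simp_rw [mul_sub]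
      rw [integral_sub (hρi.mul_const _) (hint z), integral_mul_const, hρ, one_mul]
    have e2 : ‖G z - ∫ t, ρ t * G (τ t z) ∂m‖ₑ ≤
        eLpNorm (fun t => G z - G (τ t z)) 1 P := by
      rw [e1, eLpNorm_one_eq_lintegral_enorm, hP, lintegral_withDensity_eq_lintegral_mul _ hρe
        hz.enorm]
      refine (enorm_integral_le_lintegral_enorm _).trans (le_of_eq (lintegral_congr fun t => ?_))
      rw [enorm_mul, Real.enorm_of_nonneg (hρ0 t)]
      rfl
    have e3 : eLpNorm (fun t => G z - G (τ t z)) 1 P ≤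
        eLpNorm (fun t => G z - G (τ t z)) (ENNReal.ofReal p) P :=
      eLpNorm_le_eLpNorm_of_exponent_le (by simpa using hp.le) hz.aestronglyMeasurable
    calc _ ≤ eLpNorm (fun t => G z - G (τ t z)) (ENNReal.ofReal p) P ^ p := by
          gcongr; exact e2.trans e3
      _ = _ := by
          rw [eLpNorm_rpow_eq hp, hP, lintegral_withDensity_eq_lintegral_mul _ hρe
            (hz.enorm.pow_const p)]
          rfl
  rw [← ENNReal.rpow_le_rpow_iff hp0, eLpNorm_rpow_eq hp]
  have hjm : Measurable fun a : Z × X =>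
      ENNReal.ofReal (ρ a.2) * ‖G a.1 - G (τ a.2 a.1)‖ₑ ^ p :=
    (hρe.comp measurable_snd).mul ((hdm.comp measurable_swap).enorm.pow_const p)
  calc _ ≤ ∫⁻ z, ∫⁻ t, ENNReal.ofReal (ρ t) * ‖G z - G (τ t z)‖ₑ ^ p ∂m ∂ν :=
        lintegral_mono hpt
    _ = ∫⁻ t, ∫⁻ z, ENNReal.ofReal (ρ t) * ‖G z - G (τ t z)‖ₑ ^ p ∂ν ∂m :=
        lintegral_lintegral_swap hjm.aemeasurable
    _ ≤ ∫⁻ t, ENNReal.ofReal (ρ t) * η ^ p ∂m := by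
        refine lintegral_mono fun t => ?_
        simp only
        rw [lintegral_const_mul' _ _ ENNReal.ofReal_ne_top, ← eLpNorm_rpow_eq hp]
        by_cases ht : ρ t = 0
        · simp [ht]
        · gcongr; exact hη t ht
    _ = η ^ p := by rw [lintegral_mul_const _ hρe, hmass, one_mul]

end Mollify

/-! ### Compactly supported functions are limits of test functions. -/

section MemW₀

variable {n : ℕ} {s p : ℝ}

/-- A function of `W^{s,p}(ℝⁿ)` supported in a compact subset of `O` is in `W₀^{s,p}(O)`. -/
theorem mem_W₀_of_ae_eq_zero_off_compact (hp : 1 < p) {O K : Set (E n)} (hO : IsOpen O)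
    (hK : IsCompact K) (hKO : K ⊆ O) {u : E n → ℝ} (hu : u ∈ W n s p)
    (huK : ∀ᵐ x, x ∉ K → u x = 0) : u ∈ W₀ s hp O := by
  have hp1 : 1 ≤ ENNReal.ofReal p := by simpa using hp.le
  -- A Borel representative that vanishes everywhere off `K`, so that the support and measurability
  -- arguments need no null sets.
  set w : E n → ℝ := K.indicator (hu.1.1.mk u) with hw
  have hwm : Measurable w :=
    hu.1.1.stronglyMeasurable_mk.measurable.indicator hK.measurableSet
  have hwu : w =ᵐ[volume] u := by
    filter_upwards [hu.1.1.ae_eq_mk, huK] with x h1 h2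
    by_cases hx : x ∈ K
    · rw [hw, Set.indicator_of_mem hx, h1]
    · rw [hw, Set.indicator_of_notMem hx, h2 hx]
  have hwK : Function.support w ⊆ K := Set.support_indicator_subset
  refine mem_of_ae_eq hp (sobolevClosed_W₀ hp O) (W₀_le_W hp O) ?_ hwu
  have hwW : w ∈ W n s p := mem_W_congr hwu.symm hu
  have hqm : Measurable (quot s p w) :=
    ((hwm.comp measurable_fst).sub (hwm.comp measurable_snd)).div
      ((by fun_prop : Measurable fun z : E n × E n => ‖z.1 - z.2‖).pow_const _)
  refine ⟨hwW, fun ε hε => ?_⟩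
  obtain ⟨δ₀, hδ₀, hδO⟩ := hK.exists_cthickening_subset_open hO hKO
  obtain ⟨ε', hε', hε'ε⟩ := ENNReal.lt_iff_exists_nnreal_btwn.1 (ENNReal.half_pos hε.ne')
  have hε'0 : (0 : ℝ≥0∞) < ε' := hε'
  have t1 := eventually_eLpNorm_sub_translate_le hp1 ENNReal.ofReal_ne_top hwW.1
    (ContinuousLinearMap.id ℝ (E n)) hε'0
  have hqW := hwW.2
  rw [Measure.volume_eq_prod] at hqW
  have t2 := eventually_eLpNorm_sub_translate_le hp1 ENNReal.ofReal_ne_top hqW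
    ((ContinuousLinearMap.id ℝ (E n)).prod (ContinuousLinearMap.id ℝ (E n))) hε'0
  obtain ⟨δ₁, hδ₁, hball⟩ := Metric.eventually_nhds_iff_ball.1 (t1.and t2)
  have hδ : 0 < min δ₀ δ₁ := lt_min hδ₀ hδ₁
  let b : ContDiffBump (0 : E n) := ⟨min δ₀ δ₁ / 2, min δ₀ δ₁, by linarith, by linarith⟩
  set ρ : E n → ℝ := b.normed volume with hρ
  have hρs : ∀ t, ρ t ≠ 0 → t ∈ Metric.ball (0 : E n) (min δ₀ δ₁) := fun t ht => by
    have : t ∈ Function.support ρ := ht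
    rwa [hρ, b.support_normed_eq] at this
  have hwl : LocallyIntegrable w volume := hwW.1.locallyIntegrable hp1
  have hconv := (b.hasCompactSupport_normed (μ := volume)).convolutionExists_left
    (ContinuousLinearMap.lsmul ℝ ℝ) b.continuous_normed hwl
  set φ : E n → ℝ := fun x => ∫ t, ρ t * w (x - t) with hφ
  have hφc : φ = convolution ρ w (ContinuousLinearMap.lsmul ℝ ℝ) volume := rfl
  have hint : ∀ x, Integrable (fun t => ρ t * w (x - t)) volume := fun x => hconv x
  have hφs : Function.support φ ⊆ Metric.cthickening δ₀ K := by
    intro x hx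
    by_contra hxK
    refine hx (integral_eq_zero_of_ae (.of_forall fun t => ?_))
    by_contra hne
    have h1 : ρ t ≠ 0 := fun h => hne (by simp [h])
    have h2 : w (x - t) ≠ 0 := fun h => hne (by simp [h])
    refine hxK (Metric.mem_cthickening_of_dist_le x (x - t) δ₀ K (hwK h2) ?_)
    have h3 := hρs t h1
    rw [Metric.mem_ball, dist_zero_right] at h3
    simpa using h3.le.trans (min_le_left _ _)
  have hφt : tsupport φ ⊆ Metric.cthickening δ₀ K :=
    closure_minimal hφs Metric.isClosed_cthickening
  -- The denominator is invariant under diagonal translations, so mollifying `w` averages its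
  -- quotient over the translates by (t, t).
  have hq : ∀ z, quot s p φ z = ∫ t, ρ t * quot s p w (z - (t, t)) := fun z => by
    simp only [quot, hφ]
    rw [← integral_sub (hint _) (hint _), ← integral_div]
    refine integral_congr_ae (.of_forall fun t => ?_)
    simp only [Prod.fst_sub, Prod.snd_sub, sub_sub_sub_cancel_right]
    ring
  have hintq : ∀ z, Integrable (fun t => ρ t * quot s p w (z - (t, t))) volume := fun z => by
    refine (((hint z.1).sub (hint z.2)).div_const (‖z.1 - z.2‖ ^ ((n : ℝ) / p + s))).congr
      (.of_forall fun t => ?_)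
    simp only [quot, Pi.sub_apply, Prod.fst_sub, Prod.snd_sub, sub_sub_sub_cancel_right]
    ring
  have hρm : Measurable ρ := b.continuous_normed.measurable
  have n1 : eLpNorm (w - φ) (ENNReal.ofReal p) volume ≤ ε' :=
    eLpNorm_sub_average_le hp hρm b.nonneg_normed b.integrable_normed b.integral_normed
      (τ := fun t x => x - t) (by fun_prop) hwm hint fun t ht =>
        (hball t (Metric.ball_subset_ball (min_le_right _ _) (hρs t ht))).1
  have n2 : eLpNorm (quot s p (w - φ)) (ENNReal.ofReal p) volume ≤ ε' := by
    rw [quot_sub]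
    have := eLpNorm_sub_average_le (ν := (volume : Measure (E n)).prod volume) hp hρm
      b.nonneg_normed b.integrable_normed b.integral_normed
      (τ := fun t z => z - (t, t)) (by fun_prop) hqm hintq fun t ht =>
        (hball t (Metric.ball_subset_ball (min_le_right _ _) (hρs t ht))).2
    simp_rw [← hq] at this
    exact this
  have hφd : ContDiff ℝ ∞ φ := by
    rw [hφc]
    exact b.hasCompactSupport_normed.contDiff_convolution_left _ b.contDiff_normed hwl
  have hφW : φ ∈ W n s p := by
    have hdm : AEStronglyMeasurable (w - φ) volume :=
      hwm.aestronglyMeasurable.sub hφd.continuous.aestronglyMeasurable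
    have : w - φ ∈ W n s p := ⟨⟨hdm, n1.trans_lt ENNReal.coe_lt_top⟩,
      ⟨aestronglyMeasurable_quot hdm, n2.trans_lt ENNReal.coe_lt_top⟩⟩
    simpa using sub_mem hwW this
  refine ⟨φ, hφW, ⟨hφd, hK.cthickening.of_isClosed_subset (isClosed_tsupport _) hφt,
    hφt.trans hδO⟩, ?_⟩
  refine (sobolevNorm_le_add hp _).trans_lt ?_
  rw [← ENNReal.add_halves ε]
  exact ENNReal.add_lt_add (n1.trans_lt hε'ε) (n2.trans_lt hε'ε)

end MemW₀

/-! ### Truncation at height M and cutoff by a capacitary function. -/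

section Truncation

variable {n : ℕ} {s p : ℝ}

/-- Truncation at the levels `a ≤ 0 ≤ b`. -/
noncomputable def clamp (a b t : ℝ) : ℝ := max a (min b t)

theorem abs_clamp_sub_le (a b x y : ℝ) : |clamp a b x - clamp a b y| ≤ |x - y| := by
  refine (abs_max_sub_max_le_max _ _ _ _).trans ?_
  rw [sub_self, abs_zero, max_eq_right (abs_nonneg _)]
  refine (abs_min_sub_min_le_max _ _ _ _).trans ?_
  rw [sub_self, abs_zero, max_eq_right (abs_nonneg _)]

theorem clamp_zero {a b : ℝ} (ha : a ≤ 0) (hb : 0 ≤ b) : clamp a b 0 = 0 := by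
  rw [clamp, min_eq_right hb, max_eq_right ha]

theorem abs_clamp_le {a b : ℝ} (ha : a ≤ 0) (hb : 0 ≤ b) (x : ℝ) : |clamp a b x| ≤ |x| := by
  simpa [clamp_zero ha hb] using abs_clamp_sub_le a b x 0

theorem clamp_mem_Icc {a b : ℝ} (hab : a ≤ b) (x : ℝ) : clamp a b x ∈ Set.Icc a b :=
  ⟨le_max_left _ _, max_le hab (min_le_left _ _)⟩

theorem continuous_clamp (a b : ℝ) : Continuous (clamp a b) := by unfold clamp; fun_prop

/-- Chebyshev's argument: where |x| > M one has |x| ≤ M^(1−p) |x|^p. Truncation errors in L¹ thus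
vanish as M grows, uniformly on bounded sets of L^p. -/
theorem abs_sub_clamp_le (hp : 1 < p) {M : ℝ} (hM : 0 < M) (x : ℝ) :
    |x - clamp (-M) M x| ≤ M ^ (1 - p) * |x| ^ p := by
  have h0 : 0 ≤ M ^ (1 - p) * |x| ^ p := by positivity
  rcases le_or_gt |x| M with h | h
  · obtain ⟨h1, h2⟩ := abs_le.1 h
    rwa [clamp, min_eq_right h2, max_eq_right h1, sub_self, abs_zero]
  · have hx : 0 < |x| := hM.trans h
    have h1 : |x - clamp (-M) M x| ≤ |x| := by
      rcases lt_abs.1 h with h2 | h2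
      · rw [clamp, min_eq_left h2.le, max_eq_right (by linarith), abs_of_pos (by linarith),
          abs_of_pos (by linarith)]
        linarith
      · rw [clamp, min_eq_right (by linarith), max_eq_left (by linarith), sub_neg_eq_add,
          abs_of_neg (by linarith), abs_of_neg (by linarith)]
        linarith
    refine h1.trans ?_
    have h2 : |x| ^ p = |x| ^ (p - 1) * |x| := by
      nth_rw 3 [← Real.rpow_one |x|]
      rw [← Real.rpow_add hx]; congr 1; ring
    have h3 : M ^ (1 - p) * M ^ (p - 1) = 1 := by
      rw [← Real.rpow_add hM]; simp
    have h4 : M ^ (p - 1) ≤ |x| ^ (p - 1) :=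
      Real.rpow_le_rpow hM.le h.le (by linarith)
    calc |x| = M ^ (1 - p) * (M ^ (p - 1) * |x|) := by rw [← mul_assoc, h3, one_mul]
      _ ≤ M ^ (1 - p) * (|x| ^ (p - 1) * |x|) := by gcongr
      _ = _ := by rw [h2]

/-- `u` truncated at height `M` and cut off where `w ≥ 1`. -/
noncomputable def cutoff (M : ℝ) (w u : E n → ℝ) (x : E n) : ℝ :=
  (1 - clamp 0 1 (w x)) * clamp (-M) M (u x)

/-- The discrete product rule. The bound M on the truncated `u` is what keeps the term containing
the increment of `w` under control. -/
theorem abs_quot_cutoff_le {M : ℝ} (hM : 0 ≤ M) (w u : E n → ℝ) (z : E n × E n) :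
    |quot s p (cutoff M w u) z| ≤ |quot s p u z| + M * |quot s p w z| := by
  have hr : 0 ≤ ‖z.1 - z.2‖ ^ ((n : ℝ) / p + s) := by positivity
  simp only [quot, abs_div, abs_of_nonneg hr]
  rw [mul_div_assoc', ← add_div]
  gcongr
  have e : cutoff M w u z.1 - cutoff M w u z.2 =
      (1 - clamp 0 1 (w z.1)) * (clamp (-M) M (u z.1) - clamp (-M) M (u z.2)) -
        clamp (-M) M (u z.2) * (clamp 0 1 (w z.1) - clamp 0 1 (w z.2)) := by
    simp only [cutoff]; ring
  rw [e]
  refine (abs_sub _ _).trans ?_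
  rw [abs_mul, abs_mul]
  have hw := clamp_mem_Icc zero_le_one (w z.1)
  have h1 : |1 - clamp 0 1 (w z.1)| ≤ 1 := abs_le.2 ⟨by linarith [hw.2], by linarith [hw.1]⟩
  have h2 : |clamp (-M) M (u z.2)| ≤ M := abs_le.2 (clamp_mem_Icc (by linarith) _)
  have h3 := abs_clamp_sub_le (-M) M (u z.1) (u z.2)
  have h4 := abs_clamp_sub_le 0 1 (w z.1) (w z.2)
  have h5 := mul_le_mul h1 h3 (abs_nonneg _) zero_le_one
  have h6 := mul_le_mul h2 h4 (abs_nonneg _) hM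
  linarith

theorem aestronglyMeasurable_cutoff {M : ℝ} {w u : E n → ℝ} (hw : AEStronglyMeasurable w volume)
    (hu : AEStronglyMeasurable u volume) : AEStronglyMeasurable (cutoff M w u) volume :=
  (aestronglyMeasurable_const.sub ((continuous_clamp 0 1).comp_aestronglyMeasurable hw)).mul
    ((continuous_clamp (-M) M).comp_aestronglyMeasurable hu)

theorem eLpNorm_quot_cutoff_le (hp : 1 < p) {M : ℝ} (hM : 0 ≤ M) {w u : E n → ℝ}
    (hw : w ∈ W n s p) (hu : u ∈ W n s p) :
    eLpNorm (quot s p (cutoff M w u)) (ENNReal.ofReal p) volume ≤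
      eLpNorm (quot s p u) (ENNReal.ofReal p) volume +
        ENNReal.ofReal M * eLpNorm (quot s p w) (ENNReal.ofReal p) volume := by
  have h1 : 1 ≤ ENNReal.ofReal p := by simpa using hp.le
  have h2 : eLpNorm (quot s p (cutoff M w u)) (ENNReal.ofReal p) volume ≤
      eLpNorm ((fun z => ‖quot s p u z‖) + M • fun z => ‖quot s p w z‖) (ENNReal.ofReal p)
        volume := by
    refine eLpNorm_mono_real fun z => ?_
    simpa using abs_quot_cutoff_le hM w u z
  refine (h2.trans (eLpNorm_add_le hu.2.1.norm (hw.2.1.norm.const_smul M) h1)).trans_eq ?_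
  rw [eLpNorm_const_smul, eLpNorm_norm, eLpNorm_norm, Real.enorm_of_nonneg hM]

theorem cutoff_mem_W (hp : 1 < p) {M : ℝ} (hM : 0 ≤ M) {w u : E n → ℝ} (hw : w ∈ W n s p)
    (hu : u ∈ W n s p) : cutoff M w u ∈ W n s p := by
  have hm := aestronglyMeasurable_cutoff (M := M) hw.1.1 hu.1.1
  refine ⟨hu.1.mono hm (.of_forall fun x => ?_), aestronglyMeasurable_quot hm, ?_⟩
  · have hw' := clamp_mem_Icc zero_le_one (w x)
    have h1 : |1 - clamp 0 1 (w x)| ≤ 1 := abs_le.2 ⟨by linarith [hw'.2], by linarith [hw'.1]⟩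
    rw [cutoff, norm_mul, Real.norm_eq_abs, Real.norm_eq_abs, Real.norm_eq_abs]
    have := mul_le_mul h1 (abs_clamp_le (a := -M) (by linarith) hM (u x)) (abs_nonneg _) zero_le_one
    linarith
  · refine (eLpNorm_quot_cutoff_le hp hM hw hu).trans_lt (ENNReal.add_lt_top.2 ⟨hu.2.2, ?_⟩)
    exact ENNReal.mul_lt_top ENNReal.ofReal_lt_top hw.2.2

theorem abs_sub_cutoff_le (hp : 1 < p) {M : ℝ} (hM : 0 < M) (w u : E n → ℝ) (x : E n) :
    |u x - cutoff M w u x| ≤ M ^ (1 - p) * |u x| ^ p + M * |w x| := by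
  have e : u x - cutoff M w u x = (u x - clamp (-M) M (u x)) +
      clamp 0 1 (w x) * clamp (-M) M (u x) := by simp only [cutoff]; ring
  rw [e]
  refine (abs_add_le _ _).trans (add_le_add (abs_sub_clamp_le hp hM _) ?_)
  rw [abs_mul, mul_comm]
  exact mul_le_mul (abs_le.2 (clamp_mem_Icc (by linarith) _))
    (abs_clamp_le le_rfl zero_le_one _) (abs_nonneg _) hM.le

theorem cutoff_eq_zero_of_one_le {M : ℝ} {w u : E n → ℝ} {x : E n} (h : 1 ≤ w x) :
    cutoff M w u x = 0 := by
  rw [cutoff, clamp, min_eq_left h, max_eq_right zero_le_one, sub_self, zero_mul]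

theorem cutoff_eq_zero_of_eq_zero {M : ℝ} (hM : 0 ≤ M) {w u : E n → ℝ} {x : E n} (h : u x = 0) :
    cutoff M w u x = 0 := by
  rw [cutoff, h, clamp_zero (by linarith) hM, mul_zero]

theorem cutoff_mem_W₀ae (hp : 1 < p) {M : ℝ} (hM : 0 ≤ M) {O Ω U : Set (E n)} {w u : E n → ℝ}
    (hw : w ∈ W n s p) (hwU : ∀ᵐ x, x ∈ U → 1 ≤ w x) (hU : O \ Ω ⊆ U) (hu : u ∈ W₀ae s p O) :
    cutoff M w u ∈ W₀ae s p Ω := by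
  refine ⟨cutoff_mem_W hp hM hw hu.1, ?_⟩
  filter_upwards [hwU, hu.2] with x h1 h2 hx
  by_cases hxO : x ∈ O
  · exact cutoff_eq_zero_of_one_le (h1 (hU ⟨hxO, hx⟩))
  · exact cutoff_eq_zero_of_eq_zero hM (h2 hxO)

/-- The cutoff vanishes a.e. off the compact set `tsupport φ \ U`, which lies in `Ω` because `U`
covers `O \ Ω`; the compact support of `φ` is essential. -/
theorem cutoff_mem_W₀ (hp : 1 < p) {M : ℝ} (hM : 0 ≤ M) {O Ω U : Set (E n)} {w φ : E n → ℝ}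
    (hΩ : IsOpen Ω) (hUo : IsOpen U) (hw : w ∈ W n s p) (hwU : ∀ᵐ x, x ∈ U → 1 ≤ w x)
    (hU : O \ Ω ⊆ U) (hφ : φ ∈ W n s p) (ht : IsTest O φ) : cutoff M w φ ∈ W₀ s hp Ω := by
  refine mem_W₀_of_ae_eq_zero_off_compact hp hΩ (ht.2.1.isCompact.diff hUo) ?_
    (cutoff_mem_W hp hM hw hφ) ?_
  · intro x hx
    by_contra hxΩ
    exact hx.2 (hU ⟨ht.2.2 hx.1, hxΩ⟩)
  · filter_upwards [hwU] with x h1 hx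
    by_cases hxU : x ∈ U
    · exact cutoff_eq_zero_of_one_le (h1 hxU)
    · exact cutoff_eq_zero_of_eq_zero hM
        (image_eq_zero_of_notMem_tsupport fun h => hx ⟨h, hxU⟩)

theorem setLIntegral_enorm_le (hp : 1 < p) {v : E n → ℝ} (hv : AEStronglyMeasurable v volume)
    (B : Set (E n)) : ∫⁻ x in B, ‖v x‖ₑ ≤
      eLpNorm v (ENNReal.ofReal p) volume * volume B ^ (1 - 1 / p) := by
  have h := eLpNorm_le_eLpNorm_mul_rpow_measure_univ (p := 1) (q := ENNReal.ofReal p)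
    (μ := volume.restrict B) (by simpa using hp.le) hv.restrict
  rw [eLpNorm_one_eq_lintegral_enorm, ENNReal.toReal_ofReal (by linarith),
    Measure.restrict_apply_univ, ENNReal.toReal_one, one_div_one] at h
  exact h.trans (by gcongr; exact Measure.restrict_le_self)

theorem setLIntegral_enorm_sub_cutoff_le (hp : 1 < p) {M : ℝ} (hM : 0 < M) {w u : E n → ℝ}
    (hw : w ∈ W n s p) (hu : u ∈ W n s p) (B : Set (E n)) :
    ∫⁻ x in B, ‖u x - cutoff M w u x‖ₑ ≤
      ENNReal.ofReal (M ^ (1 - p)) * eLpNorm u (ENNReal.ofReal p) volume ^ p +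
      ENNReal.ofReal M * (eLpNorm w (ENNReal.ofReal p) volume * volume B ^ (1 - 1 / p)) := by
  have hp0 : 0 ≤ p := by linarith
  have h1 : ∀ x, ‖u x - cutoff M w u x‖ₑ ≤
      ENNReal.ofReal (M ^ (1 - p)) * ‖u x‖ₑ ^ p + ENNReal.ofReal M * ‖w x‖ₑ := fun x => by
    rw [← ofReal_norm, ← ofReal_norm, ← ofReal_norm,
      ENNReal.ofReal_rpow_of_nonneg (norm_nonneg _) hp0, ← ENNReal.ofReal_mul (by positivity),
      ← ENNReal.ofReal_mul hM.le, ← ENNReal.ofReal_add (by positivity) (by positivity)]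
    exact ENNReal.ofReal_le_ofReal (abs_sub_cutoff_le hp hM w u x)
  have hum : AEMeasurable (fun x => ENNReal.ofReal (M ^ (1 - p)) * ‖u x‖ₑ ^ p)
      (volume.restrict B) := ((hu.1.1.restrict.enorm.pow_const p).const_mul _)
  refine (lintegral_mono h1).trans ?_
  rw [lintegral_add_left' hum, lintegral_const_mul' _ _ ENNReal.ofReal_ne_top,
    lintegral_const_mul' _ _ ENNReal.ofReal_ne_top, eLpNorm_rpow_eq hp]
  gcongr
  · exact Measure.restrict_le_self
  · exact setLIntegral_enorm_le hp hw.1.1 B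

end Truncation

/-! ### Both choices of zero-trace space at once, and the approximation in the limit space. -/

section Spaces

variable {n : ℕ} {s p : ℝ}

/-- Common properties of the two choices of `W₀^{s,p}(O)`, relative to the limit set `Ω`. -/
structure IsZeroTraceFamily (s : ℝ) (hp : 1 < p) (V : Set (E n) → Submodule ℝ (E n → ℝ))
    (Ω : Set (E n)) : Prop where
  le_W₀ae : ∀ O, IsOpen O → V O ≤ W₀ae s p O
  sobolevClosed : ∀ O, IsOpen O → SobolevClosed s p (V O)
  mono : ∀ O O', O ⊆ O' → V O ≤ V O'
  W₀_le : ∀ O, IsOpen O → W₀ s hp O ≤ V O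
  limit_eq : V Ω = W₀ s hp Ω
  -- The function `v` is a test function near `u` for choice (a) and `u` itself for choice (b); it
  -- is fixed before `w`, `U` and `M`.
  exists_cutoff_mem : ∀ O, IsOpen O → ∀ u ∈ V O, ∀ ε : ℝ≥0∞, 0 < ε → ∃ v ∈ W n s p,
    sobolevNorm s p (u - v) ≤ ε ∧ ∀ w ∈ W n s p, ∀ U, IsOpen U → O \ Ω ⊆ U →
      (∀ᵐ x, x ∈ U → 1 ≤ w x) → ∀ M : ℝ, 0 ≤ M → cutoff M w v ∈ V Ω

theorem isZeroTraceFamily (hp : 1 < p) {V : Set (E n) → Submodule ℝ (E n → ℝ)} {Ω : Set (E n)}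
    (hΩ : IsOpen Ω) (hV : V = W₀ s hp ∨ (V = W₀ae s p ∧ W₀ae s p Ω = W₀ s hp Ω)) :
    IsZeroTraceFamily s hp V Ω := by
  rcases hV with rfl | ⟨rfl, hΩe⟩
  · refine ⟨fun O hO => W₀_le_W₀ae hp hO, fun O _ => sobolevClosed_W₀ hp O,
      fun O O' h => W₀_mono hp h, fun O _ => le_rfl, rfl, fun O hO u hu ε hε => ?_⟩
    obtain ⟨φ, hφ, ht, h⟩ := hu.2 ε hε
    exact ⟨φ, hφ, h.le, fun w hw U hUo hU hwU M hM =>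
      cutoff_mem_W₀ hp hM hΩ hUo hw hwU hU hφ ht⟩
  · refine ⟨fun O hO => le_rfl, fun O hO => sobolevClosed_W₀ae hp hO,
      fun O O' h => W₀ae_mono h, fun O hO => W₀_le_W₀ae hp hO, hΩe, fun O hO u hu ε hε => ?_⟩
    refine ⟨u, hu.1, ?_, fun w hw U hUo hU hwU M hM => cutoff_mem_W₀ae hp hM hw hwU hU hu⟩
    rw [sub_self, sobolevNorm_zero hp]
    exact zero_le

/-- Approximation of `u ∈ V O` in `V Ω` when `O \ Ω` has small capacity. -/
theorem IsZeroTraceFamily.exists_approx {hp : 1 < p} {V : Set (E n) → Submodule ℝ (E n → ℝ)}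
    {Ω D O : Set (E n)} (hV : IsZeroTraceFamily s hp V Ω) (hO : IsOpen O) (hOD : O ⊆ D)
    (hDo : IsOpen D) {C : ℝ≥0} (hC : ∀ u : E n → ℝ, AEStronglyMeasurable u volume →
      (∀ᵐ x, x ∉ D → u x = 0) → eLpNorm u (ENNReal.ofReal p) volume ≤
        C * eLpNorm (quot s p u) (ENNReal.ofReal p) volume)
    {u : E n → ℝ} (hu : u ∈ V O) {R : ℝ} (hR : 0 ≤ R)
    (huR : eLpNorm (quot s p u) (ENNReal.ofReal p) volume ≤ ENNReal.ofReal R)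
    {r : ℝ} (hr0 : 0 < r) (hr1 : r ≤ 1) {w : E n → ℝ} (hw : w ∈ V D)
    (hwr : eLpNorm (quot s p w) (ENNReal.ofReal p) volume ≤ ENNReal.ofReal (r ^ 2))
    {U : Set (E n)} (hUo : IsOpen U) (hU : O \ Ω ⊆ U) (hwU : ∀ᵐ x, x ∈ U → 1 ≤ w x) :
    ∃ g ∈ V Ω, g ∈ W n s p ∧
      eLpNorm (quot s p g) (ENNReal.ofReal p) volume ≤ ENNReal.ofReal (R + 2) ∧
      ∀ B : Set (E n), volume B ≠ ⊤ → ∫⁻ x in B, ‖u x - g x‖ₑ ≤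
        ENNReal.ofReal ((volume B).toReal ^ (1 - 1 / p) * (r + C * r) +
          r ^ (p - 1) * (C * R + 1) ^ p) := by
  have hp0 : 0 < p := by linarith
  have hC0 : (0 : ℝ) ≤ C := C.2
  have hp1 : 1 ≤ ENNReal.ofReal p := by simpa using hp.le
  have hwD := hV.le_W₀ae D hDo hw
  have huD := hV.le_W₀ae D hDo (hV.mono O D hOD hu)
  obtain ⟨v, hv, huv, hcut⟩ := hV.exists_cutoff_mem O hO u hu (ENNReal.ofReal r) (by simpa using hr0)
  -- The height is M = 1/r while [w] ≤ r². Thus M[w] ≤ r, which gives the seminorm bound R + r + r ≤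
  -- R + 2, and the L¹ errors are governed by M‖w‖ ≤ Cr and M^(1−p) = r^(p−1).
  have hM : 0 < r⁻¹ := inv_pos.2 hr0
  have huvW : u - v ∈ W n s p := sub_mem huD.1 hv
  refine ⟨cutoff r⁻¹ w v, hcut w hwD.1 U hUo hU hwU _ hM.le, cutoff_mem_W hp hM.le hwD.1 hv, ?_,
    fun B hB => ?_⟩
  · have h1 : eLpNorm (quot s p v) (ENNReal.ofReal p) volume ≤ ENNReal.ofReal (R + r) := by
      have e : quot s p v = quot s p u - quot s p (u - v) := by rw [quot_sub, sub_sub_cancel]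
      rw [e, ENNReal.ofReal_add hR hr0.le]
      exact (eLpNorm_sub_le huD.1.2.1 huvW.2.1 hp1).trans
        (add_le_add huR ((eLpNorm_quot_le_sobolevNorm hp _).trans huv))
    refine (eLpNorm_quot_cutoff_le hp hM.le hwD.1 hv).trans ?_
    calc _ ≤ ENNReal.ofReal (R + r) + ENNReal.ofReal r⁻¹ * ENNReal.ofReal (r ^ 2) := by gcongr
      _ = ENNReal.ofReal (R + r + r) := by
        rw [← ENNReal.ofReal_mul hM.le, ← ENNReal.ofReal_add (by positivity) (by positivity)]
        congr 2
        field_simp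
      _ ≤ _ := ENNReal.ofReal_le_ofReal (by linarith)
  · have hvn : eLpNorm v (ENNReal.ofReal p) volume ≤ ENNReal.ofReal (C * R + 1) := by
      have e : v = u - (u - v) := by rw [sub_sub_cancel]
      rw [e, ENNReal.ofReal_add (by positivity) zero_le_one, ENNReal.ofReal_mul hC0,
        ENNReal.ofReal_coe_nnreal]
      refine (eLpNorm_sub_le huD.1.1.1 huvW.1.1 hp1).trans (add_le_add ?_ ?_)
      · exact (hC u huD.1.1.1 huD.2).trans (by gcongr)
      · exact ((eLpNorm_le_sobolevNorm hp _).trans huv).trans (ENNReal.ofReal_le_ofReal hr1)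
    have hwn : eLpNorm w (ENNReal.ofReal p) volume ≤ ENNReal.ofReal (C * r ^ 2) := by
      rw [ENNReal.ofReal_mul hC0, ENNReal.ofReal_coe_nnreal]
      exact (hC w hwD.1.1.1 hwD.2).trans (by gcongr)
    have hBe : volume B ^ (1 - 1 / p) = ENNReal.ofReal ((volume B).toReal ^ (1 - 1 / p)) := by
      rw [← ENNReal.ofReal_rpow_of_nonneg ENNReal.toReal_nonneg
        (by rw [sub_nonneg, div_le_one hp0]; exact hp.le), ENNReal.ofReal_toReal hB]
    set b := (volume B).toReal ^ (1 - 1 / p) with hb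
    have hb0 : 0 ≤ b := by positivity
    have h1 : ∫⁻ x in B, ‖u x - v x‖ₑ ≤ ENNReal.ofReal (b * r) := by
      refine (setLIntegral_enorm_le hp huvW.1.1 B).trans ?_
      rw [mul_comm, ENNReal.ofReal_mul hb0, hBe]
      gcongr
      exact (eLpNorm_le_sobolevNorm hp _).trans huv
    have h2 : ∫⁻ x in B, ‖v x - cutoff r⁻¹ w v x‖ₑ ≤
        ENNReal.ofReal (r ^ (p - 1) * (C * R + 1) ^ p + b * (C * r)) := by
      refine (setLIntegral_enorm_sub_cutoff_le hp hM hwD.1 hv B).trans ?_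
      have e1 : (r⁻¹) ^ (1 - p) = r ^ (p - 1) := by
        rw [Real.inv_rpow hr0.le, ← Real.rpow_neg hr0.le, neg_sub]
      have e2 : b * (C * r) = r⁻¹ * (C * r ^ 2 * b) := by field_simp
      rw [ENNReal.ofReal_add (by positivity) (by positivity), e1, e2,
        ENNReal.ofReal_mul (by positivity), ENNReal.ofReal_mul hM.le,
        ENNReal.ofReal_mul (by positivity), hBe, ← ENNReal.ofReal_rpow_of_nonneg (by positivity)
        hp0.le]
      gcongr
    have h3 : ∀ x, ‖u x - cutoff r⁻¹ w v x‖ₑ ≤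
        ‖u x - v x‖ₑ + ‖v x - cutoff r⁻¹ w v x‖ₑ := fun x => by
      rw [← sub_add_sub_cancel (u x) (v x)]
      exact enorm_add_le _ _
    refine (lintegral_mono h3).trans ?_
    have hm : AEMeasurable (fun x => ‖u x - v x‖ₑ) (volume.restrict B) :=
      huvW.1.1.restrict.enorm
    rw [lintegral_add_left' hm]
    refine (add_le_add h1 h2).trans ?_
    rw [← ENNReal.ofReal_add (by positivity) (by positivity)]
    exact ENNReal.ofReal_le_ofReal (by linarith)

end Spaces

/-! ### Use of the Hausdorff and capacity hypotheses; weak solutions as minimizers. -/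

section Final

variable {n : ℕ} {s p : ℝ}

/-- A compact `K` in `Ω` has positive distance to `closure D \ Ω`, whereas a point of `K` outside
`Ωk k` would be closer to it than the Hausdorff bound allows. -/
theorem HausdorffComplTendsto.eventually_subset {D Ω K : Set (E n)} {Ωk : ℕ → Set (E n)}
    (hH : HausdorffComplTendsto D Ωk Ω) (hΩ : IsOpen Ω) (hΩD : Ω ⊆ D) (hK : IsCompact K)
    (hKΩ : K ⊆ Ω) : ∀ᶠ k in atTop, K ⊆ Ωk k := by
  obtain ⟨r, hr, h⟩ := Metric.exists_pos_forall_lt_edist hK (isClosed_closure.sdiff hΩ)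
    (Set.disjoint_left.2 fun x hx hx' => hx'.2 (hKΩ hx) : Disjoint K (closure D \ Ω))
  filter_upwards [hH.eventually_lt_const (ENNReal.coe_pos.2 hr)] with k hk x hx
  by_contra hxk
  obtain ⟨y, hy, hxy⟩ := Metric.exists_edist_lt_of_hausdorffEDist_lt
    (show x ∈ closure D \ Ωk k from ⟨subset_closure (hΩD (hKΩ hx)), hxk⟩) hk
  exact absurd hxy (h x hx y hy).not_gt

theorem exists_of_relCap_lt (hp : 1 < p) {X : Submodule ℝ (E n → ℝ)} {A : Set (E n)} {c : ℝ≥0∞}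
    (h : relCap s p X A < c) : ∃ w ∈ X,
      eLpNorm (quot s p w) (ENNReal.ofReal p) volume ≤ c ^ (1 / p) ∧
      ∃ U, IsOpen U ∧ A ⊆ U ∧ ∀ᵐ x, x ∈ U → 1 ≤ w x := by
  rw [relCap, iInf_lt_iff] at h
  obtain ⟨w, hw⟩ := h
  rw [iInf_lt_iff] at hw
  obtain ⟨⟨hwX, hU⟩, hw⟩ := hw
  refine ⟨w, hwX, ?_, hU⟩
  rw [gagliardo_eq hp] at hw
  rw [← ENNReal.rpow_le_rpow_iff (z := p) (by linarith), ← ENNReal.rpow_mul, one_div,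
    inv_mul_cancel₀ (by linarith), ENNReal.rpow_one]
  exact hw.le

/-- With r = |x − y|^(n/p+s), the weight |x − y|^(n+sp) is r^p, shared among the three quotient
factors; on the diagonal both sides vanish. -/
theorem fracPLap_eq (hp : 1 < p) (u v : E n → ℝ) :
    fracPLap s p u v = ∫ z, |quot s p u z| ^ (p - 2) * quot s p u z * quot s p v z := by
  refine integral_congr_ae (.of_forall fun z => ?_)
  have hp0 : p ≠ 0 := by linarith
  simp only [quot]
  rcases (norm_nonneg (z.1 - z.2)).eq_or_lt with h | h
  · have : z.1 = z.2 := sub_eq_zero.1 (norm_eq_zero.1 h.symm)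
    simp [this]
  · set r := ‖z.1 - z.2‖ ^ ((n : ℝ) / p + s) with hr
    have hr0 : 0 < r := Real.rpow_pos_of_pos h _
    have e : ‖z.1 - z.2‖ ^ ((n : ℝ) + s * p) = r ^ (p - 2) * r * r := by
      have h1 : r ^ (p - 2) * r * r = r ^ p := by
        simpa [abs_of_pos hr0] using abs_rpow_sub_two_mul_self hp r
      rw [h1, hr, ← Real.rpow_mul h.le]
      congr 1
      field_simp
    have h2 : 0 < r ^ (p - 2) := Real.rpow_pos_of_pos hr0 _
    rw [e, abs_div, abs_of_pos hr0, Real.div_rpow (abs_nonneg _) hr0.le]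
    field_simp

variable [Fact (1 ≤ ENNReal.ofReal p)]

theorem norm_quotLp_le_iff {u : W n s p} {R : ℝ} (hR : 0 ≤ R) : ‖quotLp n s p u‖ ≤ R ↔
    eLpNorm (quot s p (u : E n → ℝ)) (ENNReal.ofReal p) volume ≤ ENNReal.ofReal R := by
  rw [← enorm_quotLp, ← ofReal_norm, ENNReal.ofReal_le_ofReal_iff hR]

theorem sobolevNorm_le_mul_enorm (hp : 1 < p) {D : Set (E n)} {C : ℝ≥0}
    (hC : ∀ u : E n → ℝ, AEStronglyMeasurable u volume →
      (∀ᵐ x, x ∉ D → u x = 0) → eLpNorm u (ENNReal.ofReal p) volume ≤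
        C * eLpNorm (quot s p u) (ENNReal.ofReal p) volume)
    (u : W n s p) (hu : (u : E n → ℝ) ∈ W₀ae s p D) :
    sobolevNorm s p (u : E n → ℝ) ≤ (C + 1) * ‖quotLp n s p u‖ₑ := by
  rw [enorm_quotLp, add_mul, one_mul]
  exact (sobolevNorm_le_add hp _).trans (add_le_add_left (hC _ u.2.1.1 hu.2) _)

/-- Integrals over sets of finite measure, bounded by Hölder and Poincaré, serve as the separating
functionals `ℓ` of `tendsto_of_asymptotically_mem`. -/
theorem exists_extend_setIntegral (hp : 1 < p) {D : Set (E n)} {C : ℝ≥0}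
    (hC : ∀ u : E n → ℝ, AEStronglyMeasurable u volume →
      (∀ᵐ x, x ∉ D → u x = 0) → eLpNorm u (ENNReal.ofReal p) volume ≤
        C * eLpNorm (quot s p u) (ENNReal.ofReal p) volume)
    {B : Set (E n)} (hB : volume B ≠ ⊤) :
    ∃ ℓ : Lp ℝ (ENNReal.ofReal p) (volume : Measure (E n × E n)) →L[ℝ] ℝ,
      ∀ u : W n s p, (u : E n → ℝ) ∈ W₀ae s p D → ℓ (quotLp n s p u) = ∫ x in B, (u : E n → ℝ) x := by
  have hp1 : 1 ≤ ENNReal.ofReal p := Fact.out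
  have : IsFiniteMeasure (volume.restrict B) := ⟨by
    rw [Measure.restrict_apply_univ]; exact hB.lt_top⟩
  have hint : ∀ u : W₀ae s p D, Integrable (u : E n → ℝ) (volume.restrict B) := fun u =>
    u.2.1.1.restrict B |>.integrable hp1
  let ℓ₀ : W₀ae s p D →ₗ[ℝ] ℝ :=
    { toFun := fun u => ∫ x in B, (u : E n → ℝ) x
      map_add' := fun u v => integral_add (hint u) (hint v)
      map_smul' := fun c u => integral_const_mul c _ }
  have hb : volume B ^ (1 - 1 / p) ≠ ⊤ :=
    ENNReal.rpow_ne_top_of_nonneg (by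
      rw [sub_nonneg, div_le_one (by linarith)]; exact hp.le) hB
  obtain ⟨ℓ, hℓ⟩ := exists_extend_of_bound
    ((quotLp n s p).comp (Submodule.inclusion (W₀ae_le_W D))) ℓ₀
    (C := (C * volume B ^ (1 - 1 / p)).toReal) fun u => by
      set v : W n s p := Submodule.inclusion (W₀ae_le_W D) u with hv
      have h1 : ‖ℓ₀ u‖ₑ ≤ C * volume B ^ (1 - 1 / p) * ‖quotLp n s p v‖ₑ := by
        refine (enorm_integral_le_lintegral_enorm _).trans ?_
        refine (setLIntegral_enorm_le hp u.2.1.1.1 B).trans ?_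
        rw [mul_right_comm, enorm_quotLp]
        gcongr
        exact hC _ u.2.1.1.1 u.2.2
      have h2 := ENNReal.toReal_mono (ENNReal.mul_ne_top
        (ENNReal.mul_ne_top ENNReal.coe_ne_top hb) enorm_ne_top) h1
      rw [ENNReal.toReal_mul, toReal_enorm, toReal_enorm] at h2
      exact h2
  exact ⟨ℓ, fun u hu => hℓ ⟨u, hu⟩⟩

/-- Weak solutions are the minimizers of the energy. -/
theorem isWeakSolution_iff (hp : 1 < p) {X Y : Submodule ℝ (E n → ℝ)} (hXW : X ≤ W n s p)
    (hYX : Y ≤ X) {f : X →ₗ[ℝ] ℝ}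
    {F : Lp ℝ (ENNReal.ofReal p) (volume : Measure (E n × E n)) →L[ℝ] ℝ}
    (hF : ∀ v : X, F (quotLp n s p ⟨v, hXW v.2⟩) = f v) {u : W n s p} (hu : (u : E n → ℝ) ∈ Y) :
    IsWeakSolution s p f Y (u : E n → ℝ) ↔
      ∀ z ∈ quotImage s p Y, energy F (quotLp n s p u) ≤ energy F z := by
  have key : ∀ v : W n s p, fracPLap s p (u : E n → ℝ) (v : E n → ℝ) =
      ∫ z, |quotLp n s p u z| ^ (p - 2) * quotLp n s p u z * quotLp n s p v z := fun v => by
    rw [fracPLap_eq hp]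
    refine integral_congr_ae ?_
    filter_upwards [coeFn_quotLp u, coeFn_quotLp v] with z h1 h2
    rw [h1, h2]
  rw [energy_isMin_iff hp F (quotLp_mem_quotImage hu)]
  constructor
  · rintro ⟨-, h⟩ k hk
    obtain ⟨v, hv, rfl⟩ := mem_quotImage.1 hk
    rw [← key, h ⟨v, hYX hv⟩ hv, ← hF]
  · refine fun h => ⟨hu, fun v hv => ?_⟩
    rw [← hF, ← h _ (quotLp_mem_quotImage hv)]
    exact key ⟨v, hXW v.2⟩

/-- Approximations of the members of a sequence in spaces `V (Ωk k)` by members of `V Ω`, if the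
capacity of `Ωk k \ Ω` vanishes in the limit. -/
theorem IsZeroTraceFamily.exists_approx_seq {hp : 1 < p}
    {V : Set (E n) → Submodule ℝ (E n → ℝ)} {Ω D : Set (E n)} (hV : IsZeroTraceFamily s hp V Ω)
    (hDo : IsOpen D) {Ωk : ℕ → Set (E n)} (hΩko : ∀ k, IsOpen (Ωk k)) (hΩkD : ∀ k, Ωk k ⊆ D)
    (hΩD : Ω ⊆ D)
    {C : ℝ≥0} (hC : ∀ u : E n → ℝ, AEStronglyMeasurable u volume →
      (∀ᵐ x, x ∉ D → u x = 0) → eLpNorm u (ENNReal.ofReal p) volume ≤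
        C * eLpNorm (quot s p u) (ENNReal.ofReal p) volume)
    (hcap : Tendsto (fun k => relCap s p (V D) (Ωk k \ Ω)) atTop (𝓝 0))
    {u : ℕ → W n s p} (hu : ∀ k, (u k : E n → ℝ) ∈ V (Ωk k)) {R : ℝ} (hR : 0 ≤ R)
    (huR : ∀ k, ‖quotLp n s p (u k)‖ ≤ R) :
    ∃ g : ℕ → Lp ℝ (ENNReal.ofReal p) (volume : Measure (E n × E n)),
      (∀ k, g k ∈ quotImage s p (V Ω)) ∧ (∀ k, ‖g k‖ ≤ R + 2) ∧
      ∀ (B : Set (E n)) (ℓ : Lp ℝ (ENNReal.ofReal p) (volume : Measure (E n × E n)) →L[ℝ] ℝ),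
        volume B ≠ ⊤ → (∀ v : W n s p, (v : E n → ℝ) ∈ W₀ae s p D →
          ℓ (quotLp n s p v) = ∫ x in B, (v : E n → ℝ) x) →
        Tendsto (fun k => ℓ (quotLp n s p (u k) - g k)) atTop (𝓝 0) := by
  have hp0 : 0 < p := by linarith
  -- The summand 1/(k+1) puts `e k` strictly above a finite capacity, so an admissible w exists, and
  -- keeps it positive even when the capacity is zero. The square root in `r` makes [w] ≤ r².
  set e : ℕ → ℝ≥0∞ := fun k => relCap s p (V D) (Ωk k \ Ω) + ((k : ℝ≥0∞) + 1)⁻¹ with he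
  have he0 : Tendsto e atTop (𝓝 0) := by
    have h1 : Tendsto (fun k : ℕ => ((k : ℝ≥0∞) + 1)⁻¹) atTop (𝓝 0) := by
      have := (tendsto_add_atTop_iff_nat 1).2 ENNReal.tendsto_inv_nat_nhds_zero
      simpa using this
    simpa using hcap.add h1
  have hepos : ∀ k, 0 < e k := fun k => by
    have : (0 : ℝ≥0∞) < ((k : ℝ≥0∞) + 1)⁻¹ := ENNReal.inv_pos.2 (by simp)
    exact this.trans_le le_add_self
  set r : ℕ → ℝ := fun k => √((e k ^ (1 / p)).toReal) with hr
  have hr0 : Tendsto r atTop (𝓝 0) := by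
    have h1 : Tendsto (fun k => e k ^ (1 / p)) atTop (𝓝 0) := by
      have := he0.ennrpow_const (1 / p)
      rwa [ENNReal.zero_rpow_of_pos (by positivity)] at this
    have h2 := (ENNReal.tendsto_toReal ENNReal.zero_ne_top).comp h1
    simpa [hr] using h2.sqrt
  set β : Set (E n) → ℝ → ℝ := fun B t => (volume B).toReal ^ (1 - 1 / p) * (t + C * t) +
    t ^ (p - 1) * (C * R + 1) ^ p with hβ
  have hCR : 0 ≤ (C : ℝ) * R + 1 := by positivity
  have hex : ∀ k, ∃ G ∈ quotImage s p (V Ω), ‖G‖ ≤ R + 2 ∧ (e k ≤ 1 → ∀ (B : Set (E n))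
      (ℓ : Lp ℝ (ENNReal.ofReal p) (volume : Measure (E n × E n)) →L[ℝ] ℝ),
        volume B ≠ ⊤ → (∀ v : W n s p, (v : E n → ℝ) ∈ W₀ae s p D →
          ℓ (quotLp n s p v) = ∫ x in B, (v : E n → ℝ) x) →
        |ℓ (quotLp n s p (u k) - G)| ≤ β B (r k)) := by
    intro k
    by_cases hk : e k ≤ 1
    · have hkt : e k ≠ ⊤ := ne_top_of_le_ne_top ENNReal.one_ne_top hk
      have hkt' : e k ^ (1 / p) ≠ ⊤ := ENNReal.rpow_ne_top_of_nonneg (by positivity) hkt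
      have hlt : relCap s p (V D) (Ωk k \ Ω) < e k :=
        ENNReal.lt_add_right (ne_top_of_le_ne_top hkt le_self_add)
          (ENNReal.inv_ne_zero.2 (by simp))
      obtain ⟨w, hwD, hwe, U, hUo, hU, hwU⟩ := exists_of_relCap_lt hp hlt
      have hrpos : 0 < r k :=
        Real.sqrt_pos.2 (ENNReal.toReal_pos (ENNReal.rpow_pos (hepos k) hkt).ne' hkt')
      have hr1 : r k ≤ 1 := by
        refine Real.sqrt_le_one.2 ?_
        have := ENNReal.toReal_mono ENNReal.one_ne_top
          (ENNReal.rpow_le_one hk (by positivity : 0 ≤ 1 / p))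
        simpa using this
      rw [← ENNReal.ofReal_toReal hkt', ← Real.sq_sqrt (ENNReal.toReal_nonneg (a := e k ^ (1 / p)))]
        at hwe
      obtain ⟨g, hgV, hgW, hgn, hgB⟩ := hV.exists_approx (hΩko k) (hΩkD k) hDo hC (hu k) hR
        ((norm_quotLp_le_iff hR).1 (huR k)) hrpos hr1 hwD hwe hUo hU hwU
      refine ⟨quotLp n s p ⟨g, hgW⟩, quotLp_mem_quotImage hgV,
        (norm_quotLp_le_iff (by positivity)).2 hgn, fun _ B ℓ hB hℓ => ?_⟩
      have hD : ((u k - ⟨g, hgW⟩ : W n s p) : E n → ℝ) ∈ W₀ae s p D :=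
        hV.le_W₀ae D hDo ((V D).sub_mem (hV.mono _ _ (hΩkD k) (hu k)) (hV.mono _ _ hΩD hgV))
      rw [← map_sub, hℓ _ hD, ← ENNReal.ofReal_le_ofReal_iff (by positivity), ← Real.norm_eq_abs,
        ofReal_norm]
      exact (enorm_integral_le_lintegral_enorm _).trans (hgB B hB)
    -- Since `e` tends to 0, the indices with `e k > 1` do not affect the limit and any bounded
    -- choice will do.
    · exact ⟨0, zero_mem _, by rw [norm_zero]; positivity, fun h => absurd h hk⟩
  choose g hgS hgR hgB using hex
  refine ⟨g, hgS, hgR, fun B ℓ hB hℓ => ?_⟩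
  have hβ0 : Tendsto (fun k => β B (r k)) atTop (𝓝 0) := by
    have h1 : Tendsto (fun k => r k ^ (p - 1)) atTop (𝓝 0) := by
      have := hr0.rpow_const (p := p - 1) (Or.inr (by linarith))
      rwa [Real.zero_rpow (by linarith)] at this
    have h2 := ((hr0.add (hr0.const_mul (C : ℝ))).const_mul ((volume B).toReal ^ (1 - 1 / p))).add
      (h1.mul_const ((C * R + 1) ^ p))
    simpa [hβ] using h2
  refine squeeze_zero_norm' ?_ hβ0
  filter_upwards [he0.eventually_le_const one_pos] with k hk
  exact hgB k hk B ℓ hB hℓ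

/-- Test functions give the upper bound on the energies of the solutions on `Ωk k`. -/
theorem eventually_energy_le {hp : 1 < p} {V : Set (E n) → Submodule ℝ (E n → ℝ)}
    {Ω D : Set (E n)} (hV : IsZeroTraceFamily s hp V Ω) (hΩ : IsOpen Ω) (hΩD : Ω ⊆ D)
    {Ωk : ℕ → Set (E n)} (hΩko : ∀ k, IsOpen (Ωk k)) (hH : HausdorffComplTendsto D Ωk Ω)
    {J : Lp ℝ (ENNReal.ofReal p) (volume : Measure (E n × E n)) → ℝ} (hJ : Continuous J)
    {x : ℕ → Lp ℝ (ENNReal.ofReal p) (volume : Measure (E n × E n))}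
    (hx : ∀ k, ∀ z ∈ quotImage s p (V (Ωk k)), J (x k) ≤ J z) {u : W n s p}
    (hu : (u : E n → ℝ) ∈ V Ω) {c : ℝ} (hc : J (quotLp n s p u) < c) :
    ∀ᶠ k in atTop, J (x k) ≤ c := by
  obtain ⟨ε, hε, hball⟩ := EMetric.mem_nhds_iff.1 (hJ.continuousAt.eventually_lt_const hc)
  -- Test functions on `Ω` must be dense in `V Ω`: only compact supports are sure to lie in `Ωk k`
  -- eventually.
  rw [hV.limit_eq] at hu
  obtain ⟨φ, hφ, ht, h⟩ := hu.2 ε hε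
  have h1 : J (quotLp n s p ⟨φ, hφ⟩) < c := hball (by
    rw [Metric.mem_eball, edist_comm, edist_eq_enorm_sub, ← map_sub, enorm_quotLp]
    exact (eLpNorm_quot_le_sobolevNorm hp _).trans_lt h)
  filter_upwards [hH.eventually_subset hΩ hΩD ht.2.1.isCompact ht.2.2] with k hk
  have hφV : φ ∈ V (Ωk k) := hV.W₀_le _ (hΩko k) ⟨hφ, fun ε hε =>
    ⟨φ, hφ, ⟨ht.1, ht.2.1, hk⟩, by rwa [sub_self, sobolevNorm_zero hp]⟩⟩
  exact (hx k _ (quotLp_mem_quotImage (u := ⟨φ, hφ⟩) hφV)).trans h1.le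

end Final

end FracDirichlet

/-! ### The theorem. -/

open FracDirichlet

theorem corollary3p6 {n : ℕ} (hn : 1 ≤ n) {s p : ℝ} (hs0 : 0 < s) (hs1 : s < 1) (hp : 1 < p)
    (D : Set (FracDirichlet.E n)) (hDo : IsOpen D) (hDb : Bornology.IsBounded D)
    (Ωk : ℕ → Set (FracDirichlet.E n)) (Ω : Set (FracDirichlet.E n))
    (hΩko : ∀ k, IsOpen (Ωk k)) (hΩkD : ∀ k, Ωk k ⊆ D)
    (hΩo : IsOpen Ω) (hΩD : Ω ⊆ D)
    (V : Set (FracDirichlet.E n) → Submodule ℝ (FracDirichlet.E n → ℝ))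
    (hV : V = FracDirichlet.W₀ s hp ∨
      (V = FracDirichlet.W₀ae s p ∧ FracDirichlet.W₀ae s p Ω = FracDirichlet.W₀ s hp Ω))
    (f : V D →ₗ[ℝ] ℝ) (hf : FracDirichlet.IsBoundedFunctional s p f)
    (hH : FracDirichlet.HausdorffComplTendsto D Ωk Ω)
    (hcap : Tendsto (fun k => FracDirichlet.relCap s p (V D) (Ωk k \ Ω)) atTop (𝓝 0)) :
    (∀ O : Set (FracDirichlet.E n), IsOpen O → O ⊆ D →
      ∃ w, FracDirichlet.IsWeakSolution s p f (V O) w ∧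
        ∀ w', FracDirichlet.IsWeakSolution s p f (V O) w' → w' =ᵐ[volume] w) ∧
    ∀ (uk : ℕ → FracDirichlet.E n → ℝ) (u : FracDirichlet.E n → ℝ),
      (∀ k, FracDirichlet.IsWeakSolution s p f (V (Ωk k)) (uk k)) →
      FracDirichlet.IsWeakSolution s p f (V Ω) u →
      (∀ k, uk k ∈ V D) ∧ u ∈ V D ∧
        Tendsto (fun k => FracDirichlet.sobolevNorm s p (uk k - u)) atTop (𝓝 0) := by
  have hp1 : 1 ≤ ENNReal.ofReal p := by simpa using hp.le
  have : Fact (1 ≤ ENNReal.ofReal p) := ⟨hp1⟩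
  have hVF := isZeroTraceFamily hp hΩo hV
  obtain ⟨C, hC⟩ := exists_poincare (s := s) hn hs0 hp hDb
  have hDW : V D ≤ W n s p := (hVF.le_W₀ae D hDo).trans (W₀ae_le_W D)
  have hclosed : ∀ O, IsOpen O → O ⊆ D → IsClosed (quotImage s p (V O) :
      Set (Lp ℝ (ENNReal.ofReal p) (volume : Measure (E n × E n)))) := fun O hO hOD =>
    isClosed_quotImage hn hs0 hp hDb ((hVF.mono O D hOD).trans (hVF.le_W₀ae D hDo))
      (hVF.sobolevClosed O hO)
  obtain ⟨Cf, hCf⟩ := hf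
  obtain ⟨F, hF⟩ := exists_extend_of_bound ((quotLp n s p).comp (Submodule.inclusion hDW)) f
    (C := Cf * (C + 1)) fun v => by
      have h1 := (hCf v).trans (mul_le_mul_right
        (sobolevNorm_le_mul_enorm hp hC (Submodule.inclusion hDW v) (hVF.le_W₀ae D hDo v.2))
        (Cf : ℝ≥0∞))
      have h2 := ENNReal.toReal_mono (by finiteness) h1
      rw [ENNReal.toReal_mul, ENNReal.toReal_mul, toReal_enorm, toReal_enorm, ← mul_assoc] at h2
      exact h2
  have hF' : ∀ v : V D, F (quotLp n s p ⟨v, hDW v.2⟩) = f v := hF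
  have hJ := isUnifConvexFunctional_energy hp F
  have hweak : ∀ O, O ⊆ D → ∀ w : W n s p, (w : E n → ℝ) ∈ V O →
      (IsWeakSolution s p f (V O) (w : E n → ℝ) ↔
        ∀ z ∈ quotImage s p (V O), energy F (quotLp n s p w) ≤ energy F z) := fun O hOD w hw =>
    isWeakSolution_iff hp hDW (hVF.mono O D hOD) hF' hw
  refine ⟨fun O hO hOD => ?_, fun uk u huk hu => ?_⟩
  · obtain ⟨z, hz, hmin⟩ := hJ.exists_isMinOn (hclosed O hO hOD) (quotImage s p (V O)).convex
      ⟨0, zero_mem _⟩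
    obtain ⟨w, hw, rfl⟩ := mem_quotImage.1 hz
    refine ⟨w, (hweak O hOD w hw).2 hmin, fun w' hw' => ?_⟩
    let v : W n s p := ⟨w', hDW (hVF.mono O D hOD hw'.1)⟩
    have h1 := hJ.eq_of_isMinOn (quotImage s p (V O)).convex
      (quotLp_mem_quotImage (u := v) hw'.1) hz ((hweak O hOD v hw'.1).1 hw') hmin
    have h2 := sobolevNorm_le_mul_enorm hp hC (v - w)
      (hVF.le_W₀ae D hDo (hVF.mono O D hOD ((V O).sub_mem hw'.1 hw)))
    rw [map_sub, h1, sub_self, enorm_zero, mul_zero] at h2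
    have h3 := ((eLpNorm_le_sobolevNorm hp _).trans h2).antisymm zero_le
    rw [eLpNorm_eq_zero_iff (v - w).2.1.1 (by simpa using by linarith)] at h3
    filter_upwards [h3] with x hx
    exact sub_eq_zero.1 hx
  · have hukD : ∀ k, uk k ∈ V D := fun k => hVF.mono _ _ (hΩkD k) (huk k).1
    have huD : u ∈ V D := hVF.mono _ _ hΩD hu.1
    refine ⟨hukD, huD, ?_⟩
    let U : W n s p := ⟨u, hDW huD⟩
    let Uk : ℕ → W n s p := fun k => ⟨uk k, hDW (hukD k)⟩
    have hUmin := (hweak Ω hΩD U hu.1).1 hu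
    have hUkmin := fun k => (hweak (Ωk k) (hΩkD k) (Uk k) (huk k).1).1 (huk k)
    -- Zero competes in every minimization, so coercivity bounds all solutions uniformly in k.
    obtain ⟨R, hR⟩ := hJ.coercive (energy F 0)
    have hUkR : ∀ k, ‖quotLp n s p (Uk k)‖ ≤ max R 0 := fun k =>
      (hR _ (hUkmin k 0 (zero_mem _))).trans (le_max_left _ _)
    have hR0 : 0 ≤ max R 0 := le_max_right _ _
    obtain ⟨g, hgS, hgR, hgℓ⟩ := hVF.exists_approx_seq hDo hΩko hΩkD hΩD hC hcap
      (u := Uk) (fun k => (huk k).1) hR0 hUkR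
    choose ℓ hℓ using fun B : {B : Set (E n) // volume B ≠ ⊤} =>
      exists_extend_setIntegral hp hC B.2
    have hlim : Tendsto (fun k => quotLp n s p (Uk k)) atTop (𝓝 (quotLp n s p U)) := by
      refine hJ.tendsto_of_asymptotically_mem (hclosed Ω hΩo hΩD) (hclosed D hDo le_rfl)
        (quotImage_mono (hVF.mono Ω D hΩD)) (quotLp_mem_quotImage hu.1) hUmin
        (fun k => quotLp_mem_quotImage (hukD k))
        (fun c hc => eventually_energy_le hVF hΩo hΩD hΩko hH hJ.continuous hUkmin hu.1 hc) hgS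
        (c₀ := (max R 0 + 2) ^ p / p + ‖F‖ * (max R 0 + 2)) (fun k => ?_) ℓ
        (fun B => hgℓ B (ℓ B) B.2 (hℓ B)) fun z hz hz0 => ?_
      · have h1 : -F (g k) ≤ ‖F‖ * ‖g k‖ := (neg_le_abs _).trans (F.le_opNorm _)
        have h2 := mul_le_mul_of_nonneg_left (hgR k) (norm_nonneg F)
        have h3 : ‖g k‖ ^ p / p ≤ (max R 0 + 2) ^ p / p := by
          gcongr
          exact hgR k
        rw [energy]
        linarith
      · obtain ⟨v, hv, rfl⟩ := mem_quotImage.1 hz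
        have hvD := hVF.le_W₀ae D hDo hv
        -- Separation: a function whose integrals over all sets of finite measure vanish is zero
        -- a.e.
        have h0 : (v : E n → ℝ) =ᵐ[volume] 0 := by
          have h1 := Lp.ae_eq_zero_of_forall_setIntegral_eq_zero (v.2.1.toLp (v : E n → ℝ))
            (by simpa using by linarith) ENNReal.ofReal_ne_top (fun B _ hB => ?_)
            (fun B _ hB => ?_)
          · exact (MemLp.coeFn_toLp v.2.1).symm.trans h1
          · have : IsFiniteMeasure (volume.restrict B) := ⟨by
              rw [Measure.restrict_apply_univ]; exact hB⟩
            exact ((Lp.memLp _).restrict B).integrable hp1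
          · rw [← hz0 ⟨B, hB.ne⟩, hℓ _ v hvD]
            exact integral_congr_ae (ae_restrict_of_ae (MemLp.coeFn_toLp v.2.1))
        rw [← enorm_eq_zero, enorm_quotLp, eLpNorm_congr_ae (quot_congr h0)]
        refine le_antisymm ((eLpNorm_quot_le_sobolevNorm hp _).trans ?_) zero_le
        rw [sobolevNorm_zero hp]
    have hlim' : Tendsto (fun k => ((C : ℝ≥0∞) + 1) * ‖quotLp n s p (Uk k - U)‖ₑ) atTop (𝓝 0) := by
      have h1 : Tendsto (fun k => ‖quotLp n s p (Uk k - U)‖ₑ) atTop (𝓝 0) := by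
        have := tendsto_iff_edist_tendsto_0.1 hlim
        simpa only [edist_eq_enorm_sub, ← map_sub] using this
      simpa using ENNReal.Tendsto.const_mul h1 (Or.inr (by finiteness))
    refine tendsto_of_tendsto_of_tendsto_of_le_of_le tendsto_const_nhds hlim' (fun k => zero_le)
      fun k => ?_
    exact sobolevNorm_le_mul_enorm hp hC (Uk k - U)
      (hVF.le_W₀ae D hDo ((V D).sub_mem (hukD k) huD))
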